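/- Let $(M,g)$ be a connected finite-dimensional smooth Riemannian manifold without boundary, with Riemannian distance $d$, let $I=[0,1]$, let $S\subseteq M$ be any subset (for instance a closed connected prox-regular subset), and let $x,y\in M$. Let $\mathcal B=\mathcal B_{x,y}$ be the set of absolutely continuous curves $\eta:I\to M$ with $\eta(I)\subseteq S$, $\eta(0)=x$, $\eta(1)=y$, and let $\mathcal A=\mathcal A_{x,y}$ be the set of curves $\eta\in H^1(I,M)=W^{1,2}(I,M)$ with $\eta(I)\subseteq S$, $\eta(0)=x$, $\eta(1)=y$. For an absolutely continuous $\eta$ let $\mathcal L(\eta)=\int_0^1\|\dot\eta(t)\|\,dt$, and let $f(\eta)=\frac12\int_0^1\|\dot\eta(t)\|^2\,dt$ if $\eta\in\mathcal A$ and $f(\eta)=+\infty$ otherwise. A curve $\gamma\in\mathcal B$ is called locally minimizing if for every $t_0\in I$ there exists $h>0$ such that $\mathcal L(\gamma)\le\mathcal L(\eta)$ for every $\eta\in\mathcal B$ with $\eta=\gamma$ on $I\setminus(t_0-h,t_0+h)$. Let $\gamma\in\mathcal B$. (1) The following are equivalent: (i) $\mathcal L(\gamma)\le\mathcal L(\eta)$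 for all $\eta\in\mathcal B$, and $\|\dot\gamma\|$ is constant a.e. on $I$; (ii) $f(\gamma)\le f(\eta)$ for all $\eta\in\mathcal A$. (2) The following are equivalent: (i) $\gamma$ is locally minimizing and $\|\dot\gamma\|$ is constant a.e. on $I$; (ii) $\gamma\in\mathcal A$, and for every $t_0\in I$ there exists $h>0$ such that $f(\gamma)\le f(\eta)$ for every $\eta\in\mathcal A$ with $\eta=\gamma$ on $I\setminus(t_0-h,t_0+h)$. -/

import Mathlib

open Set MeasureTheory Bundle
open scoped Manifold ContDiff ENNReal

noncomputable section

namespace CurveSpace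

/-- `v` is a weak derivative of `u` on the open interval `(a, b)`: it satisfies the integration by
parts identity against every smooth function compactly supported in `(a, b)`. -/
def HasWeakDeriv {E : Type*} [NormedAddCommGroup E] [NormedSpace ℝ E]
    (u v : ℝ → E) (a b : ℝ) : Prop :=
  ∀ φ : ℝ → ℝ, ContDiff ℝ ∞ φ → HasCompactSupport φ → tsupport φ ⊆ Ioo a b →
    ∫ t in Ioo a b, deriv φ t • u t = -∫ t in Ioo a b, φ t • v t

/-- The Sobolev space `W^{1,2}((a, b), E)`: `u` is square integrable and has a square integrable
weak derivative on `(a, b)`. -/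
def MemW12 {E : Type*} [NormedAddCommGroup E] [NormedSpace ℝ E]
    (u : ℝ → E) (a b : ℝ) : Prop :=
  MemLp u 2 (volume.restrict (Ioo a b)) ∧
    ∃ v : ℝ → E, MemLp v 2 (volume.restrict (Ioo a b)) ∧ HasWeakDeriv u v a b

/-! A curve `[0, 1] → M` is represented by a function `ℝ → M`; all the notions below depend only on
its values on `[0, 1]`. -/

variable (E : Type*) [NormedAddCommGroup E] [NormedSpace ℝ E]
  {M : Type*} [MetricSpace M] [ChartedSpace E M]

/-- The Sobolev space `H^1([0, 1], M)`: continuous curves which, read in any smooth chart, are of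
class `W^{1,2}`. Since the chart need not be bounded near the boundary of its domain, this is
required on the compact subintervals of `[0, 1]` that the curve maps into that domain. -/
def MemH1 (η : ℝ → M) : Prop :=
  ContinuousOn η (Icc 0 1) ∧
    ∀ φ ∈ IsManifold.maximalAtlas 𝓘(ℝ, E) ∞ M, ∀ a b : ℝ, 0 ≤ a → a < b → b ≤ 1 →
      MapsTo η (Icc a b) φ.source → MemW12 (fun t ↦ φ (η t)) a b

/-- The class `𝒜_{x,y}` of `H^1` curves in `S` from `x` to `y`. -/
def admissibleH1 (S : Set M) (x y : M) : Set (ℝ → M) :=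
  {η | MemH1 E η ∧ MapsTo η (Icc 0 1) S ∧ η 0 = x ∧ η 1 = y}

/-- The class `ℬ_{x,y}` of curves in `S` from `x` to `y` that are absolutely continuous (for the
distance of `M`). -/
def admissibleAC (S : Set M) (x y : M) : Set (ℝ → M) :=
  {η | AbsolutelyContinuousOnInterval η 0 1 ∧ MapsTo η (Icc 0 1) S ∧ η 0 = x ∧ η 1 = y}

variable [RiemannianBundle (fun p : M ↦ TangentSpace 𝓘(ℝ, E) p)]

/-- The length `∫₀¹ ‖η'(t)‖ dt`. -/
def length (η : ℝ → M) : ℝ≥0∞ := Manifold.pathELength 𝓘(ℝ, E) η 0 1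

open scoped Classical in
/-- The energy functional: `½ ∫₀¹ ‖η'(t)‖² dt` on `𝒜_{x,y}`, and `+∞` on all other curves. -/
def energy (S : Set M) (x y : M) (η : ℝ → M) : ℝ≥0∞ :=
  if η ∈ admissibleH1 E S x y then
    (∫⁻ t in Icc (0 : ℝ) 1, ‖mfderiv 𝓘(ℝ, ℝ) 𝓘(ℝ, E) η t 1‖ₑ ^ 2) / 2
  else ∞

/-- The speed `‖η'(t)‖` is almost everywhere constant on `[0, 1]`. -/
def HasConstantSpeed (η : ℝ → M) : Prop :=
  ∃ c : ℝ, ∀ᵐ t ∂(volume.restrict (Icc (0 : ℝ) 1)), ‖mfderiv 𝓘(ℝ, ℝ) 𝓘(ℝ, E) η t 1‖ = c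

/-- An absolutely continuous curve in `S` is locally minimizing if around every time `t₀` there is
an interval such that the curve is not longer than any absolutely continuous curve in `S` with the
same endpoints that agrees with it outside this interval. -/
def IsLocallyMinimizing (S : Set M) (γ : ℝ → M) : Prop :=
  AbsolutelyContinuousOnInterval γ 0 1 ∧ MapsTo γ (Icc 0 1) S ∧
    ∀ t₀ ∈ Icc (0 : ℝ) 1, ∃ h : ℝ, 0 < h ∧ ∀ η ∈ admissibleAC S (γ 0) (γ 1),
      EqOn η γ (Icc 0 1 \ Ioo (t₀ - h) (t₀ + h)) → length E γ ≤ length E η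

end CurveSpace

end

/-! By Cauchy-Schwarz, `(∫ ‖η'‖)² ≤ (b - a) ∫ ‖η'‖²` on every interval `[a, b]`, with equality
exactly when the speed is almost everywhere constant. Hence a shortest curve of constant speed also
minimizes the energy: `2 f(γ) = L(γ)² ≤ L(η)² ≤ 2 f(η)`.

Conversely, let `γ` have minimal energy among the curves that differ from it only in `(a, b)`, and
let `η` be an absolutely continuous competitor. Running through the same points of `η` on `[a, b]`
at speed at most `L(η|[a,b]) / (b - a)` gives an `H¹` competitor in `S`, so `(b - a) ∫ ‖γ'‖² ≤
L(η|[a,b])²` (`energy_le_sq_length_of_minimal`). The choice `η = γ` forces equality in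
Cauchy-Schwarz, hence constant speed on `[a, b]`; a general `η` gives minimality of the length. The
global statement is the case `[0, 1]`. In the local one the constants on overlapping windows agree
(`ae_eq_const_of_locally`).

The analytic basis is that `‖η'(t)‖` is the metric speed `lim dist (η s) (η t) / |s - t|`
(`hasSpeedAt_speed`), so that lengths and reparametrizations can be handled in metric terms, and
that `H¹` means absolutely continuous with square integrable speed (`memH1_iff`). -/

namespace CurveSpace

open Filter Topology
open scoped NNReal

/-! ### Metric speed of absolutely continuous curves in a metric space. -/

section MetricSpeed

variable {X Y : Type*} [PseudoMetricSpace X] [PseudoMetricSpace Y]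

/-- The metric speed of the curve `η` at time `t` exists and equals `v`. -/
def HasSpeedAt (η : ℝ → X) (v t : ℝ) : Prop :=
  Tendsto (fun s ↦ dist (η s) (η t) / |s - t|) (𝓝[≠] t) (𝓝 v)

lemma HasSpeedAt.nonneg {η : ℝ → X} {v t : ℝ} (h : HasSpeedAt η v t) : 0 ≤ v :=
  ge_of_tendsto' h fun _ ↦ div_nonneg dist_nonneg (abs_nonneg _)

lemma HasSpeedAt.le_of_eventually {η : ℝ → X} {ζ : ℝ → Y} {v w t C : ℝ} (h : HasSpeedAt η v t)
    (h' : HasSpeedAt ζ w t)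
    (hC : ∀ᶠ s in 𝓝 t, dist (η s) (η t) ≤ C * dist (ζ s) (ζ t)) : v ≤ C * w := by
  refine le_of_tendsto_of_tendsto h (h'.const_mul C) ?_
  filter_upwards [nhdsWithin_le_nhds hC] with s hs
  rw [← mul_div_assoc]
  exact div_le_div_of_nonneg_right hs (abs_nonneg _)

lemma _root_.HasDerivAt.hasSpeedAt {F : Type*} [NormedAddCommGroup F] [NormedSpace ℝ F]
    {u : ℝ → F} {u' : F} {t : ℝ} (h : HasDerivAt u u' t) : HasSpeedAt u ‖u'‖ t := by
  refine (hasDerivAt_iff_tendsto_slope.1 h).norm.congr fun s ↦ ?_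
  rw [slope_def_module, norm_smul, norm_inv, Real.norm_eq_abs, dist_eq_norm, div_eq_inv_mul]

lemma hasSpeedAt_id (t : ℝ) : HasSpeedAt (fun s : ℝ ↦ s) 1 t := by
  have := (hasDerivAt_id t).hasSpeedAt
  rwa [norm_one] at this

lemma HasSpeedAt.le_of_lipschitzOnWith {η : ℝ → X} {v t K : ℝ} {s : Set ℝ}
    (h : HasSpeedAt η v t) (hs : s ∈ 𝓝 t)
    (hK : ∀ r ∈ s, ∀ r' ∈ s, dist (η r) (η r') ≤ K * |r - r'|) : v ≤ K := by
  have := h.le_of_eventually (hasSpeedAt_id t) (C := K)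
    (by filter_upwards [hs] with r hr using hK r hr t (mem_of_mem_nhds hs))
  simpa using this

/-- Transfers absolute continuity between a curve, its chart readings and the primitives that bound
its distances. -/
lemma absolutelyContinuousOnInterval_of_dist_le {f : ℝ → X} {g : ℝ → Y} {a b C : ℝ}
    (hg : AbsolutelyContinuousOnInterval g a b)
    (h : ∀ s ∈ uIcc a b, ∀ t ∈ uIcc a b, dist (f s) (f t) ≤ C * dist (g s) (g t)) :
    AbsolutelyContinuousOnInterval f a b := by
  have hg' := Filter.Tendsto.const_mul C hg
  rw [mul_zero] at hg'
  refine squeeze_zero' ?_ ?_ hg'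
  · exact Eventually.of_forall fun _ ↦ Finset.sum_nonneg fun _ _ ↦ dist_nonneg
  · rw [eventually_inf_principal]
    filter_upwards with E hE
    rw [Finset.mul_sum]
    exact Finset.sum_le_sum fun i hi ↦ h _ (hE.1 i hi).1 _ (hE.1 i hi).2

lemma continuousOn_of_absolutelyContinuousOnInterval {f : ℝ → X} {a b : ℝ}
    (hf : AbsolutelyContinuousOnInterval f a b) : ContinuousOn f (uIcc a b) := by
  rw [absolutelyContinuousOnInterval_iff] at hf
  rw [Metric.continuousOn_iff]
  intro t ht ε hε
  obtain ⟨δ, hδ, h⟩ := hf ε hε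
  refine ⟨δ, hδ, fun s hs hst ↦ ?_⟩
  simpa using h (1, fun _ ↦ (s, t)) ⟨fun i _ ↦ ⟨hs, ht⟩, by simp⟩ (by simpa using hst)

/-- The metric speed of a continuous curve is almost everywhere measurable. -/
lemma aemeasurable_of_hasSpeedAt {η : ℝ → X} {v : ℝ → ℝ} {a b : ℝ}
    (hη : ContinuousOn η (Icc a b))
    (hv : ∀ᵐ t ∂volume.restrict (Icc a b), HasSpeedAt η (v t) t) :
    AEMeasurable v (volume.restrict (Icc a b)) := by
  rcases lt_or_ge b a with hab | hab
  · simp [Icc_eq_empty_of_lt hab]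
  rw [← restrict_Ioo_eq_restrict_Icc] at hv ⊢
  set ζ : ℝ → X := IccExtend hab ((Icc a b).domRestrict η) with hζ
  have hζc : Continuous ζ := (continuousOn_iff_continuous_domRestrict.1 hη).Icc_extend'
  have hζη : ∀ t ∈ Icc a b, ζ t = η t := fun t ht ↦ by
    rw [hζ, IccExtend_of_mem hab _ ht]; rfl
  refine aemeasurable_of_tendsto_metrizable_ae atTop
    (f := fun (n : ℕ) t ↦ dist (ζ (t + 1 / ((n : ℝ) + 1))) (ζ t) / |1 / ((n : ℝ) + 1)|) ?_ ?_
  · intro n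
    exact Continuous.aemeasurable (by fun_prop)
  · filter_upwards [hv, ae_restrict_mem measurableSet_Ioo] with t ht hmem
    have h0 : Tendsto (fun n : ℕ ↦ t + 1 / ((n : ℝ) + 1)) atTop (𝓝 t) := by
      simpa using tendsto_const_nhds.add (tendsto_one_div_add_atTop_nhds_zero_nat (𝕜 := ℝ))
    have h1 : Tendsto (fun n : ℕ ↦ t + 1 / ((n : ℝ) + 1)) atTop (𝓝[≠] t) := by
      refine tendsto_nhdsWithin_iff.2 ⟨h0, Eventually.of_forall fun n ↦ ?_⟩
      have : (0 : ℝ) < 1 / ((n : ℝ) + 1) := by positivity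
      simp only [mem_compl_iff, mem_singleton_iff]
      linarith
    refine (ht.comp h1).congr' ?_
    filter_upwards [h0 (Ioo_mem_nhds hmem.1 hmem.2)] with n hn
    simp only [Function.comp_apply]
    rw [hζη _ (Ioo_subset_Icc_self hn), hζη _ (Ioo_subset_Icc_self hmem), add_sub_cancel_left]

/-- The metric speed of an absolutely continuous curve is integrable. -/
lemma integrableOn_speed {η : ℝ → X} {v : ℝ → ℝ} {a b : ℝ} (hab : a ≤ b)
    (hη : AbsolutelyContinuousOnInterval η a b)
    (hv : ∀ᵐ t ∂volume.restrict (Icc a b), HasSpeedAt η (v t) t) :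
    IntegrableOn v (Icc a b) := by
  have hcont := continuousOn_of_absolutelyContinuousOnInterval hη
  rw [uIcc_of_le hab] at hcont
  -- the isometric embedding of the curve into a normed space of continuous functions
  set F : ℝ → C(Icc a b, ℝ) := fun r ↦
    ⟨fun s ↦ dist (η s) (η r), (continuousOn_iff_continuous_domRestrict.1 hcont).dist
      continuous_const⟩ with hF
  have hF_le : ∀ s t, dist (F s) (F t) ≤ dist (η s) (η t) := fun s t ↦
    (ContinuousMap.dist_le dist_nonneg).2 fun r ↦ by
      rw [Real.dist_eq]
      change |dist (η r) (η s) - dist (η r) (η t)| ≤ _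
      rw [dist_comm (η r), dist_comm (η r)]
      exact abs_dist_sub_le _ _ _
  -- Evaluating both functions at `s` itself attains the distance.
  have hle_F : ∀ s ∈ Icc a b, ∀ t, dist (η s) (η t) ≤ dist (F s) (F t) := fun s hs t ↦ by
    have := ContinuousMap.dist_apply_le_dist (f := F s) (g := F t) ⟨s, hs⟩
    rw [Real.dist_eq] at this
    change |dist (η s) (η s) - dist (η s) (η t)| ≤ _ at this
    rwa [dist_self, zero_sub, abs_neg, abs_of_nonneg dist_nonneg] at this
  have hFac : AbsolutelyContinuousOnInterval F a b :=
    absolutelyContinuousOnInterval_of_dist_le hη (C := 1) fun s _ t _ ↦ by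
      simpa using hF_le s t
  have hbv : LocallyBoundedVariationOn F (Icc a b) := by
    have := hFac.boundedVariationOn.locallyBoundedVariationOn
    rwa [uIcc_of_le hab] at this
  set V := variationOnFromTo F (Icc a b) a
  have hV : MonotoneOn V (Icc a b) := variationOnFromTo.monotoneOn hbv (left_mem_Icc.2 hab)
  have hle : ∀ s ∈ Icc a b, ∀ t ∈ Icc a b, dist (η s) (η t) ≤ dist (V s) (V t) := by
    intro s hs t ht
    wlog hst : s ≤ t generalizing s t
    · rw [dist_comm, dist_comm (V s)]
      exact this t ht s hs (le_of_not_ge hst)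
    have h1 : V t - V s = variationOnFromTo F (Icc a b) s t :=
      variationOnFromTo.sub_right hbv (left_mem_Icc.2 hab) ht hs
    rw [dist_comm (V s), Real.dist_eq]
    refine (hle_F s hs t).trans (le_trans ?_ (le_abs_self _))
    rw [h1, variationOnFromTo.eq_of_le _ _ hst, dist_edist]
    exact ENNReal.toReal_mono (hbv s t hs ht) (eVariationOn.edist_le _
      ⟨hs, left_mem_Icc.2 hst⟩ ⟨ht, right_mem_Icc.2 hst⟩)
  -- A monotone function has an integrable derivative. Since increments of `V` bound the distances
  -- along `η`, this derivative bounds the speed.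
  have hVi : IntervalIntegrable (deriv V) volume a b :=
    MonotoneOn.intervalIntegrable_deriv (by rwa [uIcc_of_le hab])
  rw [intervalIntegrable_iff_integrableOn_Icc_of_le hab] at hVi
  refine Integrable.mono hVi (aemeasurable_of_hasSpeedAt hcont hv).aestronglyMeasurable ?_
  have hVd := ae_restrict_of_ae (s := Ioo a b) hV.ae_differentiableWithinAt_of_mem
  rw [← restrict_Ioo_eq_restrict_Icc] at hv ⊢
  filter_upwards [hv, hVd, ae_restrict_mem measurableSet_Ioo] with t ht hVt hmem
  have hnhds : Icc a b ∈ 𝓝 t := Icc_mem_nhds hmem.1 hmem.2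
  have hVt' := ((hVt (Ioo_subset_Icc_self hmem)).differentiableAt hnhds).hasDerivAt.hasSpeedAt
  rw [Real.norm_of_nonneg ht.nonneg]
  have := ht.le_of_eventually hVt' (C := 1)
    (by filter_upwards [hnhds] with s hs
        simpa using hle s hs t (Ioo_subset_Icc_self hmem))
  simpa using this

/-- The distance between two points of an absolutely continuous curve is at most the integral of
the metric speed. -/
lemma dist_le_integral_speed {η : ℝ → X} {v : ℝ → ℝ} {a b : ℝ} (hab : a ≤ b)
    (hη : AbsolutelyContinuousOnInterval η a b)
    (hv : ∀ᵐ t ∂volume.restrict (Icc a b), HasSpeedAt η (v t) t) :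
    dist (η a) (η b) ≤ ∫ t in a..b, v t := by
  have hvi := integrableOn_speed hab hη hv
  -- The distance to the starting point is a real absolutely continuous function with derivative at
  -- most `v`, so the real fundamental theorem of calculus suffices.
  set f : ℝ → ℝ := fun r ↦ dist (η a) (η r) with hf
  have hdist : ∀ s t, dist (f s) (f t) ≤ dist (η s) (η t) := fun s t ↦ by
    rw [Real.dist_eq, hf]
    simp only
    rw [dist_comm (η a) (η s), dist_comm (η a) (η t)]
    exact abs_dist_sub_le _ _ _
  have hfac : AbsolutelyContinuousOnInterval f a b :=
    absolutelyContinuousOnInterval_of_dist_le hη (C := 1) fun s _ t _ ↦ by simpa using hdist s t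
  have hfi := hfac.integral_deriv_eq_sub
  have hfa : f a = 0 := by simp [hf]
  rw [hfa, sub_zero] at hfi
  change f b ≤ _
  rw [← hfi]
  refine intervalIntegral.integral_mono_ae_restrict hab hfac.intervalIntegrable_deriv
    ((intervalIntegrable_iff_integrableOn_Icc_of_le hab).2 hvi) ?_
  have hd := ae_restrict_of_ae (s := Icc a b) hfac.ae_differentiableAt
  filter_upwards [hv, hd, ae_restrict_mem measurableSet_Icc] with t ht hdt hmem
  rw [uIcc_of_le hab] at hdt
  have h1 := (hdt hmem).hasDerivAt.hasSpeedAt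
  have := h1.le_of_eventually ht (C := 1) (Eventually.of_forall fun s ↦ by simpa using hdist s t)
  rw [one_mul, Real.norm_eq_abs] at this
  exact (le_abs_self _).trans this

/-- On `[a, b]` the distances between the points of the curve are at most the integrals of `g`. -/
def DistLeIntegral (η : ℝ → X) (g : ℝ → ℝ) (a b : ℝ) : Prop :=
  IntegrableOn g (Icc a b) ∧
    ∀ s t, a ≤ s → s ≤ t → t ≤ b → dist (η s) (η t) ≤ ∫ r in s..t, g r

lemma distLeIntegral_speed {η : ℝ → X} {v : ℝ → ℝ} {a b : ℝ} (hab : a ≤ b)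
    (hη : AbsolutelyContinuousOnInterval η a b)
    (hv : ∀ᵐ t ∂volume.restrict (Icc a b), HasSpeedAt η (v t) t) :
    DistLeIntegral η v a b := by
  refine ⟨integrableOn_speed hab hη hv, fun s t has hst htb ↦ ?_⟩
  refine dist_le_integral_speed hst (hη.mono ?_)
    (ae_restrict_of_ae_restrict_of_subset (Icc_subset_Icc has htb) hv)
  rw [uIcc_of_le hst, uIcc_of_le hab]
  exact Icc_subset_Icc has htb

lemma DistLeIntegral.intervalIntegrable {η : ℝ → X} {g : ℝ → ℝ} {a b s t : ℝ}
    (h : DistLeIntegral η g a b) (hs : s ∈ Icc a b) (ht : t ∈ Icc a b) :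
    IntervalIntegrable g volume s t :=
  (h.1.mono_set ((uIcc_subset_Icc hs ht))).intervalIntegrable

/-- In the parameter given by the primitive of `g` the curve is 1-Lipschitz. Absolute continuity,
the reparametrization and the bound on the speed are all drawn from this form. -/
lemma DistLeIntegral.dist_le {η : ℝ → X} {g : ℝ → ℝ} {a b s t : ℝ}
    (h : DistLeIntegral η g a b) (hs : s ∈ Icc a b) (ht : t ∈ Icc a b) :
    dist (η s) (η t) ≤ dist (∫ r in a..s, g r) (∫ r in a..t, g r) := by
  have ha : a ∈ Icc a b := ⟨le_rfl, hs.1.trans hs.2⟩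
  wlog hst : s ≤ t generalizing s t
  · rw [dist_comm, dist_comm (∫ r in a..s, g r)]
    exact this ht hs (le_of_not_ge hst)
  rw [dist_comm (∫ r in a..s, g r), Real.dist_eq, intervalIntegral.integral_interval_sub_left
    (h.intervalIntegrable ha ht) (h.intervalIntegrable ha hs)]
  exact (h.2 s t hs.1 hst ht.2).trans (le_abs_self _)

lemma DistLeIntegral.absolutelyContinuousOnInterval {η : ℝ → X} {g : ℝ → ℝ} {a b : ℝ}
    (hab : a ≤ b) (h : DistLeIntegral η g a b) : AbsolutelyContinuousOnInterval η a b := by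
  refine absolutelyContinuousOnInterval_of_dist_le (C := 1)
    ((h.intervalIntegrable (left_mem_Icc.2 hab)
      (right_mem_Icc.2 hab)).absolutelyContinuousOnInterval_intervalIntegral left_mem_uIcc) ?_
  rw [uIcc_of_le hab]
  intro s hs t ht
  simpa using h.dist_le hs ht

/-- The triangle inequality at `b` handles the pairs on both sides of it. Absolute continuity of
concatenated curves is obtained by passing through this bound. -/
lemma DistLeIntegral.trans {η : ℝ → X} {g : ℝ → ℝ} {a b c : ℝ}
    (hab : a ≤ b) (hbc : b ≤ c) (h : DistLeIntegral η g a b) (h' : DistLeIntegral η g b c) :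
    DistLeIntegral η g a c := by
  have hi : IntegrableOn g (Icc a c) := by
    rw [← Icc_union_Icc_eq_Icc hab hbc]
    exact h.1.union h'.1
  refine ⟨hi, fun s t has hst htc ↦ ?_⟩
  rcases le_total t b with htb | hbt
  · exact h.2 s t has hst htb
  rcases le_total b s with hbs | hsb
  · exact h'.2 s t hbs hst htc
  rw [← intervalIntegral.integral_add_adjacent_intervals
    (h.intervalIntegrable ⟨has, hsb⟩ (right_mem_Icc.2 hab))
    (h'.intervalIntegrable (left_mem_Icc.2 hbc) ⟨hbt, htc⟩)]
  exact (dist_triangle _ (η b) _).trans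
    (add_le_add (h.2 s b has hsb le_rfl) (h'.2 b t le_rfl hbt htc))

/-- A curve dominated by an integral can be reparametrized on `[a, b]` so as to become Lipschitz
with constant the total integral divided by `b - a`. -/
lemma DistLeIntegral.exists_reparam {η : ℝ → X} {g : ℝ → ℝ} {a b : ℝ} (hab : a < b)
    (h : DistLeIntegral η g a b) :
    ∃ τ : ℝ → ℝ, MapsTo τ (Icc a b) (Icc a b) ∧ dist (η (τ a)) (η a) = 0 ∧
      dist (η (τ b)) (η b) = 0 ∧ ∀ s ∈ Icc a b, ∀ t ∈ Icc a b,
        dist (η (τ s)) (η (τ t)) ≤ ((∫ r in a..b, g r) / (b - a)) * |s - t| := by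
  set G : ℝ → ℝ := fun s ↦ ∫ r in a..s, g r with hG
  have hGc : ContinuousOn G (Icc a b) := by
    have := intervalIntegral.continuousOn_primitive_interval (μ := volume)
      (f := g) (a := a) (b := b) (by rw [uIcc_of_le hab.le]; exact h.1)
    rwa [uIcc_of_le hab.le] at this
  have hGa : G a = 0 := by simp [hG]
  have hGb : 0 ≤ G b := dist_nonneg.trans (h.2 a b le_rfl hab.le le_rfl)
  have hba : 0 < b - a := sub_pos.2 hab
  -- `G` may be constant on subintervals and need not be invertible. Any preimage of the affine
  -- value will do, because points with equal `G` are at distance zero; `τ` need not be continuous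
  -- or fix the endpoints.
  have hex : ∀ s : ℝ, ∃ t : ℝ, s ∈ Icc a b → t ∈ Icc a b ∧ G t = G b / (b - a) * (s - a) := by
    intro s
    by_cases hs : s ∈ Icc a b
    · obtain ⟨t, ht, hts⟩ := intermediate_value_Icc hab.le hGc
        (show G b / (b - a) * (s - a) ∈ Icc (G a) (G b) by
          rw [hGa]
          refine ⟨mul_nonneg (div_nonneg hGb hba.le) (sub_nonneg.2 hs.1), ?_⟩
          calc G b / (b - a) * (s - a) ≤ G b / (b - a) * (b - a) :=
                mul_le_mul_of_nonneg_left (by linarith [hs.2]) (div_nonneg hGb hba.le)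
            _ = G b := div_mul_cancel₀ _ hba.ne')
      exact ⟨t, fun _ ↦ ⟨ht, hts⟩⟩
    · exact ⟨s, fun h ↦ absurd h hs⟩
  choose τ hτ using hex
  have ha := left_mem_Icc.2 hab.le
  have hb := right_mem_Icc.2 hab.le
  refine ⟨τ, fun s hs ↦ (hτ s hs).1, ?_, ?_, fun s hs t ht ↦ ?_⟩
  · refine le_antisymm ((h.dist_le (hτ a ha).1 ha).trans_eq ?_) dist_nonneg
    change dist (G (τ a)) (G a) = 0
    rw [(hτ a ha).2, hGa]
    simp
  · refine le_antisymm ((h.dist_le (hτ b hb).1 hb).trans_eq ?_) dist_nonneg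
    change dist (G (τ b)) (G b) = 0
    rw [(hτ b hb).2, div_mul_cancel₀ _ hba.ne', dist_self]
  · refine (h.dist_le (hτ s hs).1 (hτ t ht).1).trans_eq ?_
    change dist (G (τ s)) (G (τ t)) = _
    rw [(hτ s hs).2, (hτ t ht).2, Real.dist_eq, ← mul_sub, abs_mul,
      abs_of_nonneg (div_nonneg hGb hba.le)]
    congr 2
    ring

/-- The metric speed of a curve dominated by the integral of `g` is at most `|g|`. -/
lemma DistLeIntegral.ae_speed_le {η : ℝ → X} {g v : ℝ → ℝ} {a b : ℝ} (hab : a ≤ b)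
    (h : DistLeIntegral η g a b)
    (hv : ∀ᵐ t ∂volume.restrict (Icc a b), HasSpeedAt η (v t) t) :
    ∀ᵐ t ∂volume.restrict (Icc a b), v t ≤ |g t| := by
  have hG := ae_restrict_of_ae (s := Ioo a b) ((h.intervalIntegrable (left_mem_Icc.2 hab)
    (right_mem_Icc.2 hab)).ae_hasDerivAt_integral)
  rw [← restrict_Ioo_eq_restrict_Icc] at hv ⊢
  filter_upwards [hG, hv, ae_restrict_mem measurableSet_Ioo] with t hGt hvt hmem
  have hmem' := Ioo_subset_Icc_self hmem
  rw [uIcc_of_le hab] at hGt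
  have := hvt.le_of_eventually (hGt hmem' a (left_mem_Icc.2 hab)).hasSpeedAt (C := 1) (by
    filter_upwards [Icc_mem_nhds hmem.1 hmem.2] with s hs
    simpa using h.dist_le hs hmem')
  simpa using this

/-- Two curves whose mutual distances have ratios tending to `1` have the same speed. -/
lemma HasSpeedAt.of_asymptotic {η : ℝ → X} {ζ : ℝ → Y} {v t : ℝ} (h : HasSpeedAt ζ v t)
    (h₁ : ∀ r : ℝ, 1 < r → ∀ᶠ s in 𝓝 t, dist (η s) (η t) ≤ r * dist (ζ s) (ζ t))
    (h₂ : ∀ r : ℝ, 1 < r → ∀ᶠ s in 𝓝 t, dist (ζ s) (ζ t) ≤ r * dist (η s) (η t)) :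
    HasSpeedAt η v t := by
  have hlim : Tendsto (fun r : ℝ ↦ r * v) (𝓝[>] 1) (𝓝 v) := by
    have : Continuous fun r : ℝ ↦ r * v := by fun_prop
    simpa using (this.tendsto 1).mono_left (nhdsWithin_le_nhds (s := Ioi (1 : ℝ)))
  refine tendsto_order.2 ⟨fun c hc ↦ ?_, fun c hc ↦ ?_⟩
  · have hlim' : Tendsto (fun r : ℝ ↦ r * c) (𝓝[>] 1) (𝓝 c) := by
      have : Continuous fun r : ℝ ↦ r * c := by fun_prop
      simpa using (this.tendsto 1).mono_left (nhdsWithin_le_nhds (s := Ioi (1 : ℝ)))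
    -- Some `r > 1` still satisfies `r * c < v`, which absorbs the factor lost in the comparison.
    obtain ⟨r, hrc, hr⟩ := ((hlim'.eventually_lt_const hc).and self_mem_nhdsWithin).exists
    filter_upwards [h.eventually_const_lt hrc, nhdsWithin_le_nhds (h₂ r hr)] with s hs1 hs2
    have h3 : r * c < r * (dist (η s) (η t) / |s - t|) := by
      refine hs1.trans_le ?_
      rw [← mul_div_assoc]
      exact div_le_div_of_nonneg_right hs2 (abs_nonneg _)
    exact lt_of_mul_lt_mul_left h3 (zero_le_one.trans hr.le)
  · obtain ⟨r, hrc, hr⟩ := ((hlim.eventually_lt_const hc).and self_mem_nhdsWithin).exists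
    filter_upwards [(h.const_mul r).eventually_lt_const hrc,
      nhdsWithin_le_nhds (h₁ r hr)] with s hs1 hs2
    refine lt_of_le_of_lt ?_ hs1
    rw [← mul_div_assoc]
    exact div_le_div_of_nonneg_right hs2 (abs_nonneg _)

end MetricSpeed

/-! ### From local to global on a compact interval. -/

/-- A property of compact intervals that is additive and holds locally around every point of
`[a, b]` holds for `[a, b]`. -/
lemma interval_local_to_global {P : ℝ → ℝ → Prop} {a b : ℝ} (hab : a < b)
    (hadd : ∀ c d e, a ≤ c → c < d → d < e → e ≤ b → P c d → P d e → P c e)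
    (hloc : ∀ t ∈ Icc a b, ∃ δ > 0, ∀ c d, a ≤ c → c < d → d ≤ b →
      Icc c d ⊆ Metric.ball t δ → P c d) : P a b := by
  choose! δ hδ hP using hloc
  obtain ⟨ε, hε, hcover⟩ := lebesgue_number_lemma_of_metric (s := Icc a b)
    (c := fun t : Icc a b ↦ Metric.ball (t : ℝ) (δ t)) isCompact_Icc
    (fun _ ↦ Metric.isOpen_ball)
    (fun t ht ↦ mem_iUnion.2 ⟨⟨t, ht⟩, Metric.mem_ball_self (hδ t ht)⟩)
  obtain ⟨n, hn⟩ := exists_nat_gt ((b - a) / ε)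
  have hba : 0 < b - a := sub_pos.2 hab
  have hn0 : (0 : ℝ) < n := (div_pos hba hε).trans hn
  set w := (b - a) / n with hw
  have hw0 : 0 < w := div_pos hba hn0
  have hwε : w < ε := by
    rw [hw, div_lt_iff₀ hn0]
    rwa [div_lt_iff₀ hε, mul_comm] at hn
  have hnw : n * w = b - a := mul_div_cancel₀ _ hn0.ne'
  have hstep : ∀ c, a ≤ c → c + w ≤ b → P c (c + w) := by
    intro c hac hcb
    have hc : c ∈ Icc a b := ⟨hac, by linarith⟩
    obtain ⟨⟨t, ht⟩, hsub⟩ := hcover c hc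
    refine hP t ht c (c + w) hac (by linarith) hcb (Subset.trans ?_ hsub)
    intro s hs
    rw [Metric.mem_ball, Real.dist_eq, abs_lt]
    constructor <;> linarith [hs.1, hs.2]
  -- The count starts with one step because `P` is only available on nondegenerate intervals.
  have hind : ∀ k : ℕ, k + 1 ≤ n → P a (a + (k + 1) * w) := by
    intro k
    induction k with
    | zero =>
      intro hk
      have : (1 : ℝ) ≤ n := by exact_mod_cast hk
      have := hstep a le_rfl (by nlinarith)
      simpa using this
    | succ k ih =>
      intro hk
      have hk' : (k : ℝ) + 1 + 1 ≤ n := by exact_mod_cast hk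
      have hle : a + ((k : ℝ) + 1) * w + w ≤ b := by nlinarith
      have hpos : 0 < ((k : ℝ) + 1) * w := by positivity
      have h2 := hstep (a + ((k : ℝ) + 1) * w) (by linarith) hle
      have h3 := hadd a (a + ((k : ℝ) + 1) * w) (a + ((k : ℝ) + 1) * w + w) le_rfl (by linarith)
        (by linarith) hle (ih (by omega)) h2
      have h4 : a + (((k + 1 : ℕ) : ℝ) + 1) * w = a + ((k : ℝ) + 1) * w + w := by
        push_cast; ring
      rwa [h4]
  have hn1 : 1 ≤ n := by
    have : 0 < n := by exact_mod_cast hn0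
    omega
  have := hind (n - 1) (by omega)
  have h5 : a + (((n - 1 : ℕ) : ℝ) + 1) * w = b := by
    rw [Nat.cast_sub hn1, Nat.cast_one, sub_add_cancel, hnw]
    ring
  rwa [h5] at this

/-! ### Weak derivatives and absolute continuity in normed spaces. -/

section WeakDerivative

variable {F : Type*} [NormedAddCommGroup F] [NormedSpace ℝ F]

lemma deriv_smoothTransition_eq_zero {r : ℝ} (hr : r ∉ Icc (0 : ℝ) 1) :
    deriv Real.smoothTransition r = 0 := by
  rw [mem_Icc, not_and_or, not_le, not_le] at hr
  rcases hr with hr | hr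
  · have : Real.smoothTransition =ᶠ[𝓝 r] fun _ ↦ 0 := by
      filter_upwards [Iio_mem_nhds hr] with x hx
      exact Real.smoothTransition.zero_of_nonpos (le_of_lt hx)
    simp [this.deriv_eq]
  · have : Real.smoothTransition =ᶠ[𝓝 r] fun _ ↦ 1 := by
      filter_upwards [Ioi_mem_nhds hr] with x hx
      exact Real.smoothTransition.one_of_one_le (le_of_lt hx)
    simp [this.deriv_eq]

/-- The derivative of the smooth step serves as a mollifier of mass one. It vanishes off `[0, 1]`;
the larger range leaves a margin, so that the support lies inside the half-open interval of
integration. -/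
lemma integral_deriv_smoothTransition :
    ∫ r in (-1 : ℝ)..2, deriv Real.smoothTransition r = 1 := by
  have h : ContDiff ℝ 1 Real.smoothTransition := Real.smoothTransition.contDiff
  rw [intervalIntegral.integral_deriv_eq_sub (fun x _ ↦ (h.differentiable one_ne_zero) x)
    ((h.continuous_deriv le_rfl).intervalIntegrable _ _),
    Real.smoothTransition.one_of_one_le (by norm_num),
    Real.smoothTransition.zero_of_nonpos (by norm_num), sub_zero]

/-- Averages of a continuous function against rescalings of a smooth mollifier. -/
lemma integral_mollifier [CompleteSpace F] {w : ℝ → F} {s ε : ℝ} (hε : 0 < ε) :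
    ∫ r, (ε⁻¹ * deriv Real.smoothTransition ((r - s) / ε)) • w r =
      ∫ τ in (-1 : ℝ)..2, deriv Real.smoothTransition τ • w (s + ε * τ) := by
  have h1 := intervalIntegral.integral_comp_add_mul (a := -1) (b := 2)
    (fun r ↦ deriv Real.smoothTransition ((r - s) / ε) • w r) hε.ne' s
  have h2 : ∀ τ : ℝ, (s + ε * τ - s) / ε = τ := fun τ ↦ by field_simp; ring
  simp only [h2] at h1
  rw [h1, ← intervalIntegral.integral_smul]
  simp only [smul_smul]
  rw [intervalIntegral.integral_eq_integral_of_support_subset]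
  intro r hr
  rw [Function.mem_support] at hr
  have hr' : (r - s) / ε ∈ Icc (0 : ℝ) 1 := by
    by_contra hc
    exact hr (by rw [deriv_smoothTransition_eq_zero hc, mul_zero, zero_smul])
  rw [mem_Icc, le_div_iff₀ hε, div_le_iff₀ hε] at hr'
  constructor <;> nlinarith [hr'.1, hr'.2]

/-- A continuous function with an integrable weak derivative is dominated by the integral of the
norm of this derivative. -/
lemma HasWeakDeriv.distLeIntegral [CompleteSpace F] {u v : ℝ → F} {a b : ℝ} (hab : a < b)
    (hu : ContinuousOn u (Icc a b)) (hv : IntegrableOn v (Icc a b)) (h : HasWeakDeriv u v a b) :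
    DistLeIntegral u (fun t ↦ ‖v t‖) a b := by
  have hvn : IntegrableOn (fun t ↦ ‖v t‖) (Icc a b) := hv.norm
  set G : ℝ → ℝ := fun t ↦ ∫ r in a..t, ‖v r‖ with hG
  have hGc : ContinuousOn G (Icc a b) := by
    have := intervalIntegral.continuousOn_primitive_interval (μ := volume)
      (f := fun t ↦ ‖v t‖) (a := a) (b := b) (by rw [uIcc_of_le hab.le]; exact hvn)
    rwa [uIcc_of_le hab.le] at this
  have hii : ∀ {s t}, s ∈ Icc a b → t ∈ Icc a b →
      IntervalIntegrable (fun t ↦ ‖v t‖) volume s t := fun hs ht ↦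
    (hvn.mono_set ((uIcc_subset_Icc hs ht))).intervalIntegrable
  have hGsub : ∀ {s t}, s ∈ Icc a b → t ∈ Icc a b → ∫ r in s..t, ‖v r‖ = G t - G s :=
    fun {s t} hs ht ↦ (intervalIntegral.integral_interval_sub_left
      (hii (left_mem_Icc.2 hab.le) ht) (hii (left_mem_Icc.2 hab.le) hs)).symm
  -- With a continuous extension to `ℝ`, the mollified averages are defined and continuous for every
  -- `ε`, including `0`.
  set w : ℝ → F := IccExtend hab.le ((Icc a b).domRestrict u) with hw
  have hwc : Continuous w := (continuousOn_iff_continuous_domRestrict.1 hu).Icc_extend'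
  have hwu : ∀ t ∈ Icc a b, w t = u t := fun t ht ↦ by
    rw [hw, IccExtend_of_mem hab.le _ ht]; rfl
  have hT : ContDiff ℝ ∞ Real.smoothTransition := Real.smoothTransition.contDiff
  have hT' : Continuous (deriv Real.smoothTransition) := hT.continuous_deriv (by simp)
  -- the interior case, by testing against a smooth approximation of the indicator of `[s, t]`
  have key : ∀ s ∈ Ioo a b, ∀ t ∈ Ioo a b, s ≤ t → dist (u s) (u t) ≤ G t - G s := by
    intro s hs t ht hst
    have hε : ∀ ε ∈ Ioo 0 (b - t),
        ‖(∫ τ in (-1 : ℝ)..2, deriv Real.smoothTransition τ • w (s + ε * τ)) -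
          ∫ τ in (-1 : ℝ)..2, deriv Real.smoothTransition τ • w (t + ε * τ)‖ ≤
            G (t + ε) - G s := by
      intro ε ⟨hε0, hεb⟩
      -- The two terms step up on `[s, s + ε]` and on `[t, t + ε]`. Thus `φ'` is a difference of two
      -- mollifiers, while `|φ| ≤ 1` bounds the other side of the weak identity by the integral of
      -- `‖v‖` over `[s, t + ε]`.
      set φ : ℝ → ℝ := fun r ↦
        Real.smoothTransition ((r - s) / ε) - Real.smoothTransition ((r - t) / ε) with hφ
      have hφs : ContDiff ℝ ∞ φ := by
        refine ContDiff.sub (hT.comp ?_) (hT.comp ?_) <;> fun_prop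
      have hφ0 : ∀ r, r ∉ Icc s (t + ε) → φ r = 0 := by
        intro r hr
        rw [mem_Icc, not_and_or, not_le, not_le] at hr
        rcases hr with hr | hr
        · simp only [hφ]
          rw [Real.smoothTransition.zero_of_nonpos, Real.smoothTransition.zero_of_nonpos, sub_zero]
          · exact div_nonpos_of_nonpos_of_nonneg (by linarith) hε0.le
          · exact div_nonpos_of_nonpos_of_nonneg (by linarith) hε0.le
        · simp only [hφ]
          rw [Real.smoothTransition.one_of_one_le, Real.smoothTransition.one_of_one_le, sub_self]
          · rw [le_div_iff₀ hε0]; linarith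
          · rw [le_div_iff₀ hε0]; linarith
      have hφ1 : ∀ r, |φ r| ≤ 1 := fun r ↦ by
        rw [abs_le]
        constructor <;> simp only [hφ] <;>
        linarith [Real.smoothTransition.nonneg ((r - s) / ε),
          Real.smoothTransition.nonneg ((r - t) / ε),
          Real.smoothTransition.le_one ((r - s) / ε), Real.smoothTransition.le_one ((r - t) / ε)]
      have hφsupp : tsupport φ ⊆ Icc s (t + ε) :=
        closure_minimal (fun r hr ↦ by_contra fun hc ↦ hr (hφ0 r hc)) isClosed_Icc
      have hsub : Icc s (t + ε) ⊆ Ioo a b := fun r hr ↦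
        ⟨hs.1.trans_le hr.1, hr.2.trans_lt (by linarith)⟩
      have hφc : HasCompactSupport φ :=
        isCompact_Icc.of_isClosed_subset (isClosed_tsupport _) hφsupp
      have hφd : ∀ r, deriv φ r = ε⁻¹ * deriv Real.smoothTransition ((r - s) / ε) -
          ε⁻¹ * deriv Real.smoothTransition ((r - t) / ε) := fun r ↦ by
        have hd : ∀ c, HasDerivAt (fun r ↦ Real.smoothTransition ((r - c) / ε))
            (ε⁻¹ * deriv Real.smoothTransition ((r - c) / ε)) r := fun c ↦ by
          have h1 : HasDerivAt (fun r : ℝ ↦ (r - c) / ε) ε⁻¹ r := by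
            simpa using ((hasDerivAt_id r).sub_const c).div_const ε
          have h2 := ((hT.differentiable (by simp)) ((r - c) / ε)).hasDerivAt
          rw [mul_comm]
          exact h2.comp r h1
        exact ((hd s).sub (hd t)).deriv
      have hweak := h φ hφs hφc (hφsupp.trans hsub)
      have hint : ∀ c, Integrable
          (fun r ↦ (ε⁻¹ * deriv Real.smoothTransition ((r - c) / ε)) • w r) := fun c ↦ by
        refine Continuous.integrable_of_hasCompactSupport (by fun_prop) ?_
        refine HasCompactSupport.intro (isCompact_Icc (a := c) (b := c + ε)) fun r hr ↦ ?_
        rw [deriv_smoothTransition_eq_zero, mul_zero, zero_smul]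
        rwa [mem_Icc, le_div_iff₀ hε0, div_le_iff₀ hε0, zero_mul, one_mul, sub_nonneg,
          sub_le_iff_le_add', ← mem_Icc]
      have hleft : ∫ r in Ioo a b, deriv φ r • u r =
          (∫ τ in (-1 : ℝ)..2, deriv Real.smoothTransition τ • w (s + ε * τ)) -
          ∫ τ in (-1 : ℝ)..2, deriv Real.smoothTransition τ • w (t + ε * τ) := by
        rw [← integral_mollifier hε0, ← integral_mollifier hε0, ← integral_sub (hint s) (hint t)]
        simp only [← sub_smul, ← hφd]
        refine (setIntegral_congr_fun measurableSet_Ioo fun r hr ↦ ?_).trans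
          (setIntegral_eq_integral_of_forall_compl_eq_zero fun r hr ↦ ?_)
        · simp only [hwu r (Ioo_subset_Icc_self hr)]
        · have : deriv φ r = 0 := by
            by_contra hc
            exact hr (hsub (hφsupp (support_deriv_subset (f := φ) hc)))
          rw [this, zero_smul]
      rw [← hleft, hweak, norm_neg,
        ← hGsub (Ioo_subset_Icc_self hs) ⟨by linarith [ht.1], by linarith⟩,
        intervalIntegral.integral_of_le (by linarith), ← integral_Icc_eq_integral_Ioc]
      have hz : ∫ r in Ioo a b, φ r • v r = ∫ r in Icc s (t + ε), φ r • v r := by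
        rw [setIntegral_eq_of_subset_of_forall_sdiff_eq_zero measurableSet_Ioo hsub]
        intro r hr
        rw [hφ0 r hr.2, zero_smul]
      rw [hz]
      refine norm_integral_le_of_norm_le
        (hvn.mono_set (hsub.trans Ioo_subset_Icc_self)) (Eventually.of_forall fun r ↦ ?_)
      rw [norm_smul]
      exact mul_le_of_le_one_left (norm_nonneg _) (hφ1 r)
    have hK : ∀ c, Continuous fun ε : ℝ ↦
        ∫ τ in (-1 : ℝ)..2, deriv Real.smoothTransition τ • w (c + ε * τ) := fun c ↦
      intervalIntegral.continuous_parametric_intervalIntegral_of_continuous' (by fun_prop) _ _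
    have hK0 : ∀ c, ∫ τ in (-1 : ℝ)..2, deriv Real.smoothTransition τ • w (c + 0 * τ) = w c := by
      intro c
      simp only [zero_mul, add_zero]
      rw [intervalIntegral.integral_smul_const, integral_deriv_smoothTransition, one_smul]
    have hlim1 : Tendsto (fun ε : ℝ ↦
        ‖(∫ τ in (-1 : ℝ)..2, deriv Real.smoothTransition τ • w (s + ε * τ)) -
          ∫ τ in (-1 : ℝ)..2, deriv Real.smoothTransition τ • w (t + ε * τ)‖) (𝓝[>] 0)
          (𝓝 ‖w s - w t‖) := by
      have := (((hK s).sub (hK t)).norm.tendsto 0).mono_left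
        (nhdsWithin_le_nhds (s := Ioi (0 : ℝ)))
      simp only [Pi.sub_apply, hK0] at this
      exact this
    have hlim2 : Tendsto (fun ε : ℝ ↦ G (t + ε) - G s) (𝓝[>] 0) (𝓝 (G t - G s)) := by
      have hGt : ContinuousAt G t := hGc.continuousAt (Icc_mem_nhds ht.1 ht.2)
      have : Tendsto (fun ε : ℝ ↦ t + ε) (𝓝[>] 0) (𝓝 t) := by
        have h0 : Continuous fun ε : ℝ ↦ t + ε := by fun_prop
        have := (h0.tendsto 0).mono_left (nhdsWithin_le_nhds (s := Ioi (0 : ℝ)))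
        rwa [add_zero] at this
      exact (hGt.tendsto.comp this).sub_const _
    have := le_of_tendsto_of_tendsto hlim1 hlim2
      (by filter_upwards [Ioo_mem_nhdsGT (sub_pos.2 ht.2)] with ε hε' using hε ε hε')
    rwa [hwu s (Ioo_subset_Icc_self hs), hwu t (Ioo_subset_Icc_self ht), ← dist_eq_norm] at this
  have key' : ∀ p ∈ Ioo a b ×ˢ Ioo a b, dist (u p.1) (u p.2) ≤ |G p.2 - G p.1| := by
    rintro ⟨s, t⟩ ⟨hs, ht⟩
    rcases le_total s t with hst | hts
    · exact (key s hs t ht hst).trans (le_abs_self _)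
    · rw [dist_comm, abs_sub_comm]
      exact (key t ht s hs hts).trans (le_abs_self _)
  refine ⟨hvn, fun s t has hst htb ↦ ?_⟩
  have hsm : s ∈ Icc a b := ⟨has, hst.trans htb⟩
  have htm : t ∈ Icc a b := ⟨has.trans hst, htb⟩
  -- Test functions only see the open interval; the endpoints are reached by continuity of `u` and
  -- `G`.
  have hcl : closure (Ioo a b ×ˢ Ioo a b) = Icc a b ×ˢ Icc a b := by
    rw [closure_prod_eq, closure_Ioo hab.ne]
  have h1 : MapsTo (Prod.fst : ℝ × ℝ → ℝ) (Icc a b ×ˢ Icc a b) (Icc a b) := fun p hp ↦ hp.1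
  have h2 : MapsTo (Prod.snd : ℝ × ℝ → ℝ) (Icc a b ×ˢ Icc a b) (Icc a b) := fun p hp ↦ hp.2
  have := le_on_closure (x := (s, t)) key'
    (by rw [hcl]
        exact continuous_dist.comp_continuousOn ((hu.comp continuousOn_fst h1).prodMk (hu.comp continuousOn_snd h2)))
    (by rw [hcl]
        exact ((hGc.comp continuousOn_snd h2).sub (hGc.comp continuousOn_fst h1)).abs)
    (by rw [hcl]; exact ⟨hsm, htm⟩)
  have hnonneg : 0 ≤ ∫ r in s..t, ‖v r‖ :=
    intervalIntegral.integral_nonneg hst fun _ _ ↦ norm_nonneg _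
  rw [← hGsub hsm htm, abs_of_nonneg hnonneg] at this
  exact this

variable [FiniteDimensional ℝ F]

lemma ae_differentiableAt_of_absolutelyContinuous {u : ℝ → F} {a b : ℝ} (hab : a ≤ b)
    (hu : AbsolutelyContinuousOnInterval u a b) :
    ∀ᵐ t ∂volume.restrict (Icc a b), DifferentiableAt ℝ u t := by
  have hbv := hu.boundedVariationOn.locallyBoundedVariationOn
  rw [uIcc_of_le hab] at hbv
  have := ae_restrict_of_ae (s := Ioo a b) hbv.ae_differentiableWithinAt_of_mem
  rw [← restrict_Ioo_eq_restrict_Icc]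
  filter_upwards [this, ae_restrict_mem measurableSet_Ioo] with t ht hmem
  exact (ht (Ioo_subset_Icc_self hmem)).differentiableAt (Icc_mem_nhds hmem.1 hmem.2)

lemma integrableOn_deriv_of_absolutelyContinuous {u : ℝ → F} {a b : ℝ} (hab : a ≤ b)
    (hu : AbsolutelyContinuousOnInterval u a b) : IntegrableOn (deriv u) (Icc a b) := by
  have := FiniteDimensional.complete ℝ F
  have h := integrableOn_speed (v := fun t ↦ ‖deriv u t‖) hab hu (by
    filter_upwards [ae_differentiableAt_of_absolutelyContinuous hab hu] with t ht
    exact ht.hasDerivAt.hasSpeedAt)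
  exact (integrable_norm_iff (stronglyMeasurable_deriv u).aestronglyMeasurable).1 h

/-- The fundamental theorem of calculus for absolutely continuous functions with values in a
finite-dimensional space. -/
lemma integral_deriv_of_absolutelyContinuous {u : ℝ → F} {a b : ℝ} (hab : a ≤ b)
    (hu : AbsolutelyContinuousOnInterval u a b) : ∫ t in a..b, deriv u t = u b - u a := by
  have := FiniteDimensional.complete ℝ F
  have hi := (intervalIntegrable_iff_integrableOn_Icc_of_le hab).2
    (integrableOn_deriv_of_absolutelyContinuous hab hu)
  -- Functionals separate points, which reduces the identity to real-valued functions.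
  rw [SeparatingDual.eq_iff_forall_dual_eq (R := ℝ)]
  intro L
  have hL : AbsolutelyContinuousOnInterval (fun t ↦ L (u t)) a b :=
    absolutelyContinuousOnInterval_of_dist_le hu (C := ‖L‖) fun s _ t _ ↦ by
      rw [dist_eq_norm, dist_eq_norm, ← map_sub]
      exact L.le_opNorm _
  rw [map_sub, ← hL.integral_deriv_eq_sub, ← L.intervalIntegral_comp_comm hi]
  refine intervalIntegral.integral_congr_ae_restrict ?_
  rw [uIoc_of_le hab]
  filter_upwards [ae_restrict_of_ae_restrict_of_subset Ioc_subset_Icc_self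
    (ae_differentiableAt_of_absolutelyContinuous hab hu)] with t ht
  exact ((L.hasFDerivAt.comp_hasDerivAt t ht.hasDerivAt).deriv).symm

/-- The fundamental theorem of calculus applied to `φ • u`, which is absolutely continuous and
vanishes at both endpoints. -/
lemma hasWeakDeriv_of_absolutelyContinuous {u : ℝ → F} {a b : ℝ} (hab : a ≤ b)
    (hu : AbsolutelyContinuousOnInterval u a b) : HasWeakDeriv u (deriv u) a b := by
  intro φ hφ hφc hφs
  have hφac : AbsolutelyContinuousOnInterval φ a b :=
    (hφ.of_le (by simp)).contDiffOn.absolutelyContinuousOnInterval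
  have h := integral_deriv_of_absolutelyContinuous hab (hφac.fun_smul hu)
  have h0 : ∀ t, t ∉ Ioo a b → φ t = 0 := fun t ht ↦
    image_eq_zero_of_notMem_tsupport fun hc ↦ ht (hφs hc)
  rw [h0 a (by simp), h0 b (by simp), zero_smul, zero_smul, sub_zero] at h
  have hucont := hu.continuousOn
  rw [uIcc_of_le hab] at hucont
  have hud := integrableOn_deriv_of_absolutelyContinuous hab hu
  have h1 : IntegrableOn (fun t ↦ deriv φ t • u t) (Ioo a b) :=
    (((hφ.continuous_deriv (by simp)).continuousOn.smul hucont).integrableOn_Icc).mono_set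
      Ioo_subset_Icc_self
  have h2 : IntegrableOn (fun t ↦ φ t • deriv u t) (Ioo a b) :=
    (hud.continuousOn_smul hφ.continuous.continuousOn isCompact_Icc).mono_set Ioo_subset_Icc_self
  rw [eq_neg_iff_add_eq_zero, ← integral_add h1 h2, ← h, intervalIntegral.integral_of_le hab,
    integral_Ioc_eq_integral_Ioo]
  refine integral_congr_ae ?_
  filter_upwards [ae_restrict_of_ae_restrict_of_subset Ioo_subset_Icc_self
    (ae_differentiableAt_of_absolutelyContinuous hab hu)] with t ht
  rw [add_comm]
  exact (((hφ.differentiable (by simp)) t).hasDerivAt.smul ht.hasDerivAt).deriv.symm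

end WeakDerivative

/-! ### Charts are almost isometric near their base point. -/

section Chart

variable {E : Type*} [NormedAddCommGroup E] [NormedSpace ℝ E]
  {M : Type*} [MetricSpace M] [ChartedSpace E M] [IsManifold 𝓘(ℝ, E) 1 M]

variable (E) in
/-- The identification of the model space with the tangent space at `x` given by the preferred chart
at `x`. -/
noncomputable def tangentCoord (x : M) : E →L[ℝ] TangentSpace 𝓘(ℝ, E) x :=
  (trivializationAt E (TangentSpace 𝓘(ℝ, E)) x).symmL ℝ x

lemma continuousLinearMapAt_tangentCoord (x : M) (v : E) :
    (trivializationAt E (TangentSpace 𝓘(ℝ, E)) x).continuousLinearMapAt ℝ x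
      (tangentCoord E x v) = v :=
  (trivializationAt E (TangentSpace 𝓘(ℝ, E)) x).continuousLinearMapAt_symmL
    (FiberBundle.mem_baseSet_trivializationAt' x) v

lemma tangentCoord_continuousLinearMapAt (x : M) (v : TangentSpace 𝓘(ℝ, E) x) :
    tangentCoord E x
      ((trivializationAt E (TangentSpace 𝓘(ℝ, E)) x).continuousLinearMapAt ℝ x v) = v :=
  (trivializationAt E (TangentSpace 𝓘(ℝ, E)) x).symmL_continuousLinearMapAt
    (FiberBundle.mem_baseSet_trivializationAt' x) v

attribute [local instance] normedAddCommGroupTangentSpaceVectorSpace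
  normedSpaceTangentSpaceVectorSpace

variable [RiemannianBundle (fun p : M ↦ TangentSpace 𝓘(ℝ, E) p)]
  [IsContinuousRiemannianBundle E (fun p : M ↦ TangentSpace 𝓘(ℝ, E) p)]
  [IsRiemannianManifold 𝓘(ℝ, E) M]

/-- The distance is at most the length of the curve that is a straight segment in the chart. Near
`x` the metric is close to its value at `x`, by continuity, so this length exceeds the norm in `T_x
M` by a factor at most `r`. -/
lemma exists_edist_le_tangentCoord (x : M) {r : ℝ≥0} (hr : 1 < r) :
    ∃ V ∈ 𝓝 x, ∀ y ∈ V, ∀ z ∈ V, edist y z ≤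
      r * ‖tangentCoord E x (extChartAt 𝓘(ℝ, E) x z - extChartAt 𝓘(ℝ, E) x y)‖ₑ := by
  have hU := eventually_norm_symmL_trivializationAt_comp_self_lt E
    (fun p : M ↦ TangentSpace 𝓘(ℝ, E) p) x (r := r) (by exact_mod_cast hr)
  set φ := extChartAt 𝓘(ℝ, E) x with hφ
  have hU' : φ.symm ⁻¹' {y | ‖((trivializationAt E (TangentSpace 𝓘(ℝ, E)) x).symmL ℝ y) ∘L
      ((trivializationAt E (TangentSpace 𝓘(ℝ, E)) x).continuousLinearMapAt ℝ x)‖ < r} ∈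
      𝓝 (φ x) := by
    apply (continuousAt_extChartAt_symm x).preimage_mem_nhds
    rw [extChartAt_to_inv]
    exact hU
  obtain ⟨ε, ε_pos, hε⟩ := Metric.mem_nhds_iff.1 (inter_mem (extChartAt_target_mem_nhds x) hU')
  refine ⟨φ.source ∩ φ ⁻¹' Metric.ball (φ x) ε, inter_mem (extChartAt_source_mem_nhds x)
    ((continuousAt_extChartAt x).preimage_mem_nhds (Metric.ball_mem_nhds _ ε_pos)), ?_⟩
  rintro y ⟨hys, hy⟩ z ⟨hzs, hz⟩
  let η := ContinuousAffineMap.lineMap (R := ℝ) (φ y) (φ z)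
  set γ := φ.symm ∘ η with hγ
  have hη : Icc 0 1 ⊆ ⇑η ⁻¹' (φ.target ∩ φ.symm ⁻¹' {y | ‖((trivializationAt E
      (TangentSpace 𝓘(ℝ, E)) x).symmL ℝ y) ∘L ((trivializationAt E
      (TangentSpace 𝓘(ℝ, E)) x).continuousLinearMapAt ℝ x)‖ < r}) := by
    simp only [← image_subset_iff, ContinuousAffineMap.coe_lineMap_eq,
     ← segment_eq_image_lineMap, η]
    exact Subset.trans ((convex_ball _ _).segment_subset hy hz) hε
  have η_smooth : ContMDiffOn 𝓘(ℝ, ℝ) 𝓘(ℝ, E) 1 η (Icc 0 1) := by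
    apply ContMDiff.contMDiffOn
    rw [contMDiff_iff_contDiff]
    exact ContinuousAffineMap.contDiff _
  have hlen : edist y z ≤ Manifold.pathELength 𝓘(ℝ, E) γ 0 1 := by
    rw [IsRiemannianManifold.out (I := 𝓘(ℝ, E)) y z]
    apply Manifold.riemannianEDist_le_pathELength _ _ _ zero_le_one
    · exact (contMDiffOn_extChartAt_symm x).comp η_smooth fun t ht ↦ (hη ht).1
    · simp only [hγ, Function.comp_apply, η, ContinuousAffineMap.coe_lineMap_eq,
        AffineMap.lineMap_apply_zero]
      exact φ.left_inv hys
    · simp only [hγ, Function.comp_apply, η, ContinuousAffineMap.coe_lineMap_eq,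
        AffineMap.lineMap_apply_one]
      exact φ.left_inv hzs
  refine hlen.trans ?_
  rw [Manifold.pathELength_eq_lintegral_mfderivWithin_Icc]
  have : ∀ t ∈ Icc (0 : ℝ) 1, ‖mfderivWithin 𝓘(ℝ, ℝ) 𝓘(ℝ, E) γ (Icc 0 1) t 1‖ₑ ≤
      r * ‖tangentCoord E x (φ z - φ y)‖ₑ := by
    intro t ht
    obtain ⟨ht1, ht2⟩ := hη ht
    set p := φ.symm (η t) with hp
    have hps : p ∈ (chartAt E x).source := by
      have := φ.map_target ht1
      rwa [hφ, extChartAt_source] at this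
    have hφp : φ p = η t := φ.right_inv ht1
    have hηd : HasFDerivWithinAt η ((ContinuousLinearMap.id ℝ ℝ).smulRight (φ z - φ y))
        (Icc 0 1) t := by
      have h := AffineMap.hasDerivWithinAt_lineMap (a := φ y) (b := φ z) (s := Icc (0 : ℝ) 1) (x := t)
      exact h.hasFDerivWithinAt
    have hsymm := (mdifferentiableWithinAt_extChartAt_symm (I := 𝓘(ℝ, E)) ht1).hasMFDerivWithinAt
    have hηm : HasMFDerivWithinAt 𝓘(ℝ, ℝ) 𝓘(ℝ, E) η (Icc 0 1) t
        ((ContinuousLinearMap.id ℝ ℝ).smulRight (φ z - φ y)) := hηd.hasMFDerivWithinAt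
    have hcomp := hsymm.comp t hηm (fun s _ ↦ by simp)
    have hder := hcomp.mfderivWithin
      ((uniqueDiffOn_Icc (zero_lt_one (α := ℝ))).uniqueMDiffOn t ht)
    have hs := TangentBundle.symmL_trivializationAt (I := 𝓘(ℝ, E)) (𝕜 := ℝ) hps
    rw [← hφ, hφp] at hs
    have hval : mfderivWithin 𝓘(ℝ, ℝ) 𝓘(ℝ, E) γ (Icc 0 1) t 1 =
        (trivializationAt E (TangentSpace 𝓘(ℝ, E)) x).symmL ℝ p (φ z - φ y) := by
      rw [hs]
      have h1 := congrArg (fun L ↦ L (1 : ℝ)) hder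
      refine h1.trans ?_
      change mfderivWithin 𝓘(ℝ, E) 𝓘(ℝ, E) φ.symm (range 𝓘(ℝ, E)) (η t) ((1 : ℝ) • (φ z - φ y)) = _
      rw [one_smul]
      rfl
    -- Passing through the fibre at `x` exhibits the velocity as the image of a fixed vector of `T_x
    -- M` under an operator of norm less than `r`.
    rw [hval, ← continuousLinearMapAt_tangentCoord x (φ z - φ y)]
    have hle := ((trivializationAt E (TangentSpace 𝓘(ℝ, E)) x).symmL ℝ p ∘L
      (trivializationAt E (TangentSpace 𝓘(ℝ, E)) x).continuousLinearMapAt ℝ x).le_opENorm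
        (tangentCoord E x (φ z - φ y))
    refine hle.trans ?_
    rw [continuousLinearMapAt_tangentCoord]
    gcongr
    exact enorm_le_coe.2 (le_of_lt ht2)
  calc _ ≤ ∫⁻ t in Icc (0 : ℝ) 1, r * ‖tangentCoord E x (φ z - φ y)‖ₑ :=
        setLIntegral_mono' measurableSet_Icc this
    _ = _ := by simp

/-- A nearly shortest path between points close to `x` cannot leave a small ball around `x`. There
the coordinate derivative is at most `r` times the Riemannian speed, and integrating along the path
bounds the coordinate difference. -/
lemma exists_tangentCoord_le_edist [FiniteDimensional ℝ E] (x : M) {r : ℝ≥0} (hr : 1 < r) :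
    ∃ V ∈ 𝓝 x, ∀ y ∈ V, ∀ z ∈ V,
      ‖tangentCoord E x (extChartAt 𝓘(ℝ, E) x z - extChartAt 𝓘(ℝ, E) x y)‖ₑ ≤ r * edist y z := by
  have hU := eventually_norm_symmL_trivializationAt_self_comp_lt E
    (fun p : M ↦ TangentSpace 𝓘(ℝ, E) p) x (r := r) (by exact_mod_cast hr)
  set φ := extChartAt 𝓘(ℝ, E) x with hφ
  obtain ⟨ρ, ρ_pos, hρ⟩ := Metric.mem_nhds_iff.1 (inter_mem (extChartAt_source_mem_nhds
    (I := 𝓘(ℝ, E)) x) hU)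
  refine ⟨Metric.ball x (ρ / 4), Metric.ball_mem_nhds _ (by positivity), fun y hy z hz ↦ ?_⟩
  have hyz : edist y z < ENNReal.ofReal (ρ / 2) := by
    rw [edist_lt_ofReal]
    rw [Metric.mem_ball] at hy hz
    linarith [dist_triangle_right y z x]
  refine ENNReal.le_of_forall_pos_le_add fun δ hδ _ ↦ ?_
  have hr0 : (0 : ℝ≥0) < r := zero_lt_one.trans hr
  -- The length allowed for the path: the slack `δ / r` costs `δ` after multiplication by `r`, and
  -- the cap `ρ / 2` keeps a path that starts within `ρ / 4` of `x` inside the ball of radius `ρ`.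
  obtain ⟨q, hq1, hq2, hq3⟩ : ∃ q : ℝ≥0∞, edist y z < q ∧ q ≤ ENNReal.ofReal (ρ / 2) ∧
      r * q ≤ r * edist y z + δ := by
    refine ⟨min (ENNReal.ofReal (ρ / 2)) (edist y z + δ / r), lt_min hyz ?_, min_le_left _ _, ?_⟩
    · refine ENNReal.lt_add_right (edist_ne_top _ _) ?_
      exact (ENNReal.div_pos (by exact_mod_cast hδ.ne') ENNReal.coe_ne_top).ne'
    · calc (r : ℝ≥0∞) * min (ENNReal.ofReal (ρ / 2)) (edist y z + δ / r)
          ≤ r * (edist y z + δ / r) := by gcongr; exact min_le_right _ _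
        _ = r * edist y z + δ := by
          rw [mul_add, ENNReal.mul_div_cancel (by exact_mod_cast hr0.ne') ENNReal.coe_ne_top]
  refine le_trans ?_ hq3
  rw [IsRiemannianManifold.out (I := 𝓘(ℝ, E)) y z] at hq1
  obtain ⟨γ, γ0, γ1, γ_smooth, hγ⟩ := Manifold.exists_lt_of_riemannianEDist_lt hq1
  have hγρ : ∀ t ∈ Icc (0 : ℝ) 1, γ t ∈ Metric.ball x ρ := by
    intro t ht
    have h1 : edist y (γ t) < ENNReal.ofReal (ρ / 2) := by
      rw [IsRiemannianManifold.out (I := 𝓘(ℝ, E)) y (γ t)]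
      refine lt_of_le_of_lt (Manifold.riemannianEDist_le_pathELength
        (γ_smooth.mono (Icc_subset_Icc_right ht.2)) γ0 rfl ht.1) ?_
      exact (Manifold.pathELength_mono le_rfl ht.2).trans_lt (hγ.trans_le hq2)
    rw [edist_lt_ofReal] at h1
    rw [Metric.mem_ball] at hy ⊢
    linarith [dist_triangle (γ t) y x, dist_comm (γ t) y]
  have hmaps : MapsTo γ (Icc 0 1) (chartAt E x).source := fun t ht ↦ by
    have := (hρ (hγρ t ht)).1
    rwa [extChartAt_source] at this
  have hu : ContDiffOn ℝ 1 (φ ∘ γ) (Icc 0 1) := by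
    rw [← contMDiffOn_iff_contDiffOn]
    exact contMDiffOn_extChartAt.comp γ_smooth hmaps
  have hAu : ContDiffOn ℝ 1 (fun t ↦ tangentCoord E x (φ (γ t))) (Icc 0 1) :=
    (tangentCoord E x).contDiff.comp_contDiffOn hu
  have hFTC := enorm_sub_le_lintegral_derivWithin_Icc_of_contDiffOn_Icc hAu zero_le_one
  rw [γ0, γ1, ← map_sub] at hFTC
  refine hFTC.trans ?_
  have : ∀ t ∈ Icc (0 : ℝ) 1,
      ‖derivWithin (fun t ↦ tangentCoord E x (φ (γ t))) (Icc 0 1) t‖ₑ ≤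
        r * ‖mfderivWithin 𝓘(ℝ, ℝ) 𝓘(ℝ, E) γ (Icc 0 1) t 1‖ₑ := by
    intro t ht
    have hU := (uniqueDiffOn_Icc (zero_lt_one (α := ℝ))) t ht
    have hγd := (γ_smooth.mdifferentiableOn one_ne_zero t ht).hasMFDerivWithinAt
    have hφd := (mdifferentiableAt_extChartAt (I := 𝓘(ℝ, E)) (hmaps ht)).hasMFDerivAt
    have hcomp := (hφd.comp_hasMFDerivWithinAt t hγd).hasFDerivWithinAt
    have hs := TangentBundle.continuousLinearMapAt_trivializationAt (I := 𝓘(ℝ, E)) (𝕜 := ℝ)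
      (hmaps ht)
    have hA := (((tangentCoord E x).hasFDerivAt.comp_hasFDerivWithinAt t
      hcomp).hasDerivWithinAt).derivWithin hU
    have hval : derivWithin (fun t ↦ tangentCoord E x (φ (γ t))) (Icc 0 1) t =
        tangentCoord E x ((trivializationAt E (TangentSpace 𝓘(ℝ, E)) x).continuousLinearMapAt ℝ
          (γ t) (mfderivWithin 𝓘(ℝ, ℝ) 𝓘(ℝ, E) γ (Icc 0 1) t 1)) := by
      rw [hs]
      exact hA
    rw [hval]
    have hle := ((trivializationAt E (TangentSpace 𝓘(ℝ, E)) x).symmL ℝ x ∘L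
      (trivializationAt E (TangentSpace 𝓘(ℝ, E)) x).continuousLinearMapAt ℝ (γ t)).le_opENorm
        (mfderivWithin 𝓘(ℝ, ℝ) 𝓘(ℝ, E) γ (Icc 0 1) t 1)
    refine hle.trans ?_
    gcongr
    exact enorm_le_coe.2 (le_of_lt (hρ (hγρ t ht)).2)
  calc _ ≤ ∫⁻ t in Icc (0 : ℝ) 1, r * ‖mfderivWithin 𝓘(ℝ, ℝ) 𝓘(ℝ, E) γ (Icc 0 1) t 1‖ₑ :=
        setLIntegral_mono' measurableSet_Icc this
    _ = r * Manifold.pathELength 𝓘(ℝ, E) γ 0 1 := by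
        rw [lintegral_const_mul' _ _ ENNReal.coe_ne_top,
          Manifold.pathELength_eq_lintegral_mfderivWithin_Icc]
    _ ≤ r * q := by gcongr

end Chart

/-! ### The Riemannian speed is the metric speed. -/

section Speed

variable (E : Type*) [NormedAddCommGroup E] [NormedSpace ℝ E]
  {M : Type*} [MetricSpace M] [ChartedSpace E M]
  [RiemannianBundle (fun p : M ↦ TangentSpace 𝓘(ℝ, E) p)]

/-- The speed `‖η'(t)‖` of a curve. -/
noncomputable def speed (η : ℝ → M) (t : ℝ) : ℝ := ‖mfderiv 𝓘(ℝ, ℝ) 𝓘(ℝ, E) η t 1‖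

lemma speed_nonneg (η : ℝ → M) (t : ℝ) : 0 ≤ speed E η t := norm_nonneg _

lemma enorm_mfderiv_eq_ofReal_speed (η : ℝ → M) (t : ℝ) :
    ‖mfderiv 𝓘(ℝ, ℝ) 𝓘(ℝ, E) η t 1‖ₑ = ENNReal.ofReal (speed E η t) :=
  (ofReal_norm _).symm

lemma speed_congr {η ζ : ℝ → M} {t : ℝ} (h : η =ᶠ[𝓝 t] ζ) : speed E η t = speed E ζ t := by
  have h1 := h.eq_of_nhds
  unfold speed
  rw [h.mfderiv_eq]
  congr!

variable [FiniteDimensional ℝ E] [IsManifold 𝓘(ℝ, E) 1 M]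
  [IsContinuousRiemannianBundle E (fun p : M ↦ TangentSpace 𝓘(ℝ, E) p)]
  [IsRiemannianManifold 𝓘(ℝ, E) M]

lemma exists_tangentCoord_bilipschitz (x : M) {r : ℝ} (hr : 1 < r) :
    ∃ V ∈ 𝓝 x, ∀ y ∈ V, ∀ z ∈ V,
      dist y z ≤ r * dist (tangentCoord E x (extChartAt 𝓘(ℝ, E) x y))
        (tangentCoord E x (extChartAt 𝓘(ℝ, E) x z)) ∧
      dist (tangentCoord E x (extChartAt 𝓘(ℝ, E) x y))
        (tangentCoord E x (extChartAt 𝓘(ℝ, E) x z)) ≤ r * dist y z := by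
  lift r to ℝ≥0 using (zero_le_one.trans hr.le)
  have hr' : 1 < r := by exact_mod_cast hr
  obtain ⟨V, hV, h⟩ := exists_edist_le_tangentCoord (E := E) x hr'
  obtain ⟨W, hW, h'⟩ := exists_tangentCoord_le_edist (E := E) x hr'
  refine ⟨V ∩ W, inter_mem hV hW, fun y hy z hz ↦ ?_⟩
  have h1 := h y hy.1 z hz.1
  have h2 := h' y hy.2 z hz.2
  rw [map_sub, ← edist_eq_enorm_sub, edist_comm (tangentCoord E x _)] at h1 h2
  rw [dist_edist, dist_edist, ← ENNReal.coe_toReal r, ← ENNReal.toReal_mul, ← ENNReal.toReal_mul]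
  exact ⟨ENNReal.toReal_mono (ENNReal.mul_ne_top ENNReal.coe_ne_top (edist_ne_top _ _)) h1,
    ENNReal.toReal_mono (ENNReal.mul_ne_top ENNReal.coe_ne_top (edist_ne_top _ _)) h2⟩

/-- The preferred charts of a Riemannian manifold are locally bi-Lipschitz. -/
lemma exists_chartAt_bilipschitz (x : M) :
    ∃ K : ℝ, 0 ≤ K ∧ ∃ V ∈ 𝓝 x, V ⊆ (chartAt E x).source ∧ ∀ y ∈ V, ∀ z ∈ V,
      dist y z ≤ K * dist (chartAt E x y) (chartAt E x z) ∧
      dist (chartAt E x y) (chartAt E x z) ≤ K * dist y z := by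
  obtain ⟨V, hV, h⟩ := exists_tangentCoord_bilipschitz E x one_lt_two
  set A := tangentCoord E x
  set B := (trivializationAt E (TangentSpace 𝓘(ℝ, E)) x).continuousLinearMapAt ℝ x with hB
  have hBA : ∀ v w : E, dist v w ≤ ‖B‖ * dist (A v) (A w) := fun v w ↦ by
    have := B.le_opNorm (A v - A w)
    rw [map_sub, continuousLinearMapAt_tangentCoord, continuousLinearMapAt_tangentCoord] at this
    rwa [dist_eq_norm, dist_eq_norm]
  have hA : ∀ v w : E, dist (A v) (A w) ≤ ‖A‖ * dist v w := fun v w ↦ by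
    rw [dist_eq_norm, dist_eq_norm, ← map_sub]
    exact A.le_opNorm _
  refine ⟨2 * (‖A‖ + ‖B‖), by positivity, V ∩ (chartAt E x).source,
    inter_mem hV (chart_source_mem_nhds E x), inter_subset_right, fun y hy z hz ↦ ?_⟩
  obtain ⟨h1, h2⟩ := h y hy.1 z hz.1
  simp only [mfld_simps] at h1 h2
  have h3 := hA (chartAt E x y) (chartAt E x z)
  have h4 := hBA (chartAt E x y) (chartAt E x z)
  have hn1 := norm_nonneg A
  have hn2 := norm_nonneg B
  constructor
  · nlinarith [dist_nonneg (x := chartAt E x y) (y := chartAt E x z)]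
  · nlinarith [dist_nonneg (x := y) (y := z), mul_le_mul_of_nonneg_left h2 hn2]

variable {E}

/-- The norm of the derivative of a curve is its metric speed. -/
lemma hasSpeedAt_speed {η : ℝ → M} {t : ℝ} (h : MDifferentiableAt 𝓘(ℝ, ℝ) 𝓘(ℝ, E) η t) :
    HasSpeedAt η (speed E η t) t := by
  set x := η t with hx
  have hxs := mem_chart_source E x
  have hφd := (mdifferentiableAt_extChartAt (I := 𝓘(ℝ, E)) hxs).hasMFDerivAt
  have hcomp := (HasMFDerivAt.comp t hφd h.hasMFDerivAt).hasFDerivAt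
  have hs := TangentBundle.continuousLinearMapAt_trivializationAt (I := 𝓘(ℝ, E)) (𝕜 := ℝ) hxs
  have hA := ((tangentCoord E x).hasFDerivAt.comp t hcomp).hasDerivAt
  -- At the base point, `tangentCoord` undoes the derivative of the chart, so the norm of `T_x M` is
  -- recovered exactly.
  have hval : ‖((tangentCoord E x).comp ((mfderiv 𝓘(ℝ, E) 𝓘(ℝ, E) (extChartAt 𝓘(ℝ, E) x) x).comp
      (mfderiv 𝓘(ℝ, ℝ) 𝓘(ℝ, E) η t))) 1‖ = speed E η t := by
    have := tangentCoord_continuousLinearMapAt (E := E) x (mfderiv 𝓘(ℝ, ℝ) 𝓘(ℝ, E) η t 1)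
    rw [hs] at this
    exact congrArg norm this
  have hsp := hA.hasSpeedAt
  replace hsp : HasSpeedAt (fun s ↦ tangentCoord E x (extChartAt 𝓘(ℝ, E) x (η s)))
      (speed E η t) t := by
    rw [← hval]
    exact hsp
  -- The coordinates distort distances near `x` by a factor `r` that may be taken arbitrarily close
  -- to `1`, hence the speeds are equal and not merely comparable.
  refine hsp.of_asymptotic (fun r hr ↦ ?_) (fun r hr ↦ ?_)
  · obtain ⟨V, hV, hVr⟩ := exists_tangentCoord_bilipschitz E x hr
    filter_upwards [h.continuousAt.preimage_mem_nhds hV] with s hs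
    exact (hVr _ hs _ (mem_of_mem_nhds hV)).1
  · obtain ⟨V, hV, hVr⟩ := exists_tangentCoord_bilipschitz E x hr
    filter_upwards [h.continuousAt.preimage_mem_nhds hV] with s hs
    exact (hVr _ hs _ (mem_of_mem_nhds hV)).2

/-- A continuous curve stays, for a short time, in a domain on which the chart is bi-Lipschitz. -/
lemma exists_chartAt_bilipschitz_curve {η : ℝ → M} {a b t : ℝ} (hη : ContinuousOn η (Icc a b))
    (ht : t ∈ Icc a b) :
    ∃ K : ℝ, 0 ≤ K ∧ ∃ δ > 0, ∀ c d, a ≤ c → c < d → d ≤ b → Icc c d ⊆ Metric.ball t δ →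
      MapsTo η (Icc c d) (chartAt E (η t)).source ∧ ∀ r ∈ Icc c d, ∀ s ∈ Icc c d,
        dist (η r) (η s) ≤ K * dist (chartAt E (η t) (η r)) (chartAt E (η t) (η s)) ∧
        dist (chartAt E (η t) (η r)) (chartAt E (η t) (η s)) ≤ K * dist (η r) (η s) := by
  obtain ⟨K, hK, V, hV, hVs, h⟩ := exists_chartAt_bilipschitz E (η t)
  obtain ⟨δ, hδ, hδV⟩ := Metric.mem_nhdsWithin_iff.1 ((hη t ht).preimage_mem_nhdsWithin hV)
  refine ⟨K, hK, δ, hδ, fun c d hac hcd hdb hsub ↦ ?_⟩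
  have hin : ∀ r ∈ Icc c d, η r ∈ V := fun r hr ↦
    hδV ⟨hsub hr, hac.trans hr.1, hr.2.trans hdb⟩
  exact ⟨fun r hr ↦ hVs (hin r hr), fun r hr s hs ↦ h _ (hin r hr) _ (hin s hs)⟩

/-- An absolutely continuous curve is differentiable almost everywhere. -/
lemma ae_mdifferentiableAt {η : ℝ → M} {a b : ℝ} (hab : a ≤ b)
    (hη : AbsolutelyContinuousOnInterval η a b) :
    ∀ᵐ t ∂volume.restrict (Icc a b), MDifferentiableAt 𝓘(ℝ, ℝ) 𝓘(ℝ, E) η t := by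
  rcases hab.eq_or_lt with rfl | hab
  · simp
  have hcont := continuousOn_of_absolutelyContinuousOnInterval hη
  rw [uIcc_of_le hab.le] at hcont
  refine interval_local_to_global (P := fun c d ↦ ∀ᵐ t ∂volume.restrict (Icc c d),
    MDifferentiableAt 𝓘(ℝ, ℝ) 𝓘(ℝ, E) η t) hab ?_ ?_
  · intro c d e _ hcd hde _ h1 h2
    rw [← Icc_union_Icc_eq_Icc hcd.le hde.le]
    exact ae_restrict_union_iff _ _ _ |>.2 ⟨h1, h2⟩
  · intro t ht
    obtain ⟨K, -, δ, hδ, h⟩ := exists_chartAt_bilipschitz_curve (E := E) hcont ht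
    refine ⟨δ, hδ, fun c d hac hcd hdb hsub ↦ ?_⟩
    obtain ⟨hmaps, hbl⟩ := h c d hac hcd hdb hsub
    have hηcd : AbsolutelyContinuousOnInterval η c d := hη.mono (by
      rw [uIcc_of_le hcd.le, uIcc_of_le hab.le]
      exact Icc_subset_Icc hac hdb)
    -- In the chart the curve has bounded variation with values in a finite-dimensional space, hence
    -- is differentiable almost everywhere.
    have hu : AbsolutelyContinuousOnInterval (fun s ↦ chartAt E (η t) (η s)) c d :=
      absolutelyContinuousOnInterval_of_dist_le hηcd (C := K) (by
        rw [uIcc_of_le hcd.le]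
        exact fun r hr s hs ↦ (hbl r hr s hs).2)
    have hd := ae_differentiableAt_of_absolutelyContinuous hcd.le hu
    rw [← restrict_Ioo_eq_restrict_Icc] at hd ⊢
    filter_upwards [hd, ae_restrict_mem measurableSet_Ioo] with s hs hmem
    have hmem' := Ioo_subset_Icc_self hmem
    rw [mdifferentiableAt_iff_target_of_mem_source (I' := 𝓘(ℝ, E)) (hmaps hmem')]
    refine ⟨hcont.continuousAt (mem_of_superset (Icc_mem_nhds hmem.1 hmem.2)
      (Icc_subset_Icc hac hdb)), ?_⟩
    rw [mdifferentiableAt_iff_differentiableAt]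
    have heq : extChartAt 𝓘(ℝ, E) (η t) ∘ η = fun s ↦ chartAt E (η t) (η s) := by
      ext s
      simp
    rw [heq]
    exact hs

lemma ae_hasSpeedAt_speed {η : ℝ → M} {a b : ℝ} (hab : a ≤ b)
    (hη : AbsolutelyContinuousOnInterval η a b) :
    ∀ᵐ t ∂volume.restrict (Icc a b), HasSpeedAt η (speed E η t) t := by
  filter_upwards [ae_mdifferentiableAt (E := E) hab hη] with t ht
  exact hasSpeedAt_speed ht

lemma distLeIntegral_speed_of_absolutelyContinuous {η : ℝ → M} {a b : ℝ} (hab : a ≤ b)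
    (hη : AbsolutelyContinuousOnInterval η a b) : DistLeIntegral η (speed E η) a b :=
  distLeIntegral_speed hab hη (ae_hasSpeedAt_speed hab hη)

end Speed

/-! ### `H¹` curves are the absolutely continuous curves with square integrable speed. -/

section Sobolev

variable {E : Type*} [NormedAddCommGroup E] [NormedSpace ℝ E] [FiniteDimensional ℝ E]
  {M : Type*} [MetricSpace M] [ChartedSpace E M] [IsManifold 𝓘(ℝ, E) ∞ M]
  [RiemannianBundle (fun p : M ↦ TangentSpace 𝓘(ℝ, E) p)]
  [IsContinuousRiemannianBundle E (fun p : M ↦ TangentSpace 𝓘(ℝ, E) p)]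
  [IsRiemannianManifold 𝓘(ℝ, E) M]

/-- Every smooth chart of a Riemannian manifold is locally Lipschitz. -/
lemma locallyLipschitzOn_of_mem_maximalAtlas {φ : OpenPartialHomeomorph M E}
    (hφ : φ ∈ IsManifold.maximalAtlas 𝓘(ℝ, E) ∞ M) : LocallyLipschitzOn φ.source φ := by
  intro x hx
  obtain ⟨K, hK, V, hV, hVs, h⟩ := exists_chartAt_bilipschitz E x
  have hφx : ContMDiffAt 𝓘(ℝ, E) 𝓘(ℝ, E) 1 φ x :=
    (contMDiffAt_of_mem_maximalAtlas hφ hx).of_le (by simp)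
  have hsymm : ContMDiffAt 𝓘(ℝ, E) 𝓘(ℝ, E) 1 (chartAt E x).symm (chartAt E x x) :=
    contMDiffAt_symm_of_mem_maximalAtlas (IsManifold.chart_mem_maximalAtlas x)
      (mem_chart_target E x)
  have hcomp : ContDiffAt ℝ 1 (φ ∘ (chartAt E x).symm) (chartAt E x x) := by
    rw [← contMDiffAt_iff_contDiffAt]
    refine ContMDiffAt.comp _ ?_ hsymm
    rwa [(chartAt E x).left_inv (mem_chart_source E x)]
  obtain ⟨L, t, ht, hL⟩ := hcomp.exists_lipschitzOnWith
  refine ⟨L * K.toNNReal, V ∩ chartAt E x ⁻¹' t, mem_nhdsWithin_of_mem_nhds (inter_mem hV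
    (((chartAt E x).continuousAt (mem_chart_source E x)).preimage_mem_nhds ht)), ?_⟩
  refine LipschitzOnWith.of_dist_le_mul fun y hy z hz ↦ ?_
  have h1 := hL.dist_le_mul _ hy.2 _ hz.2
  simp only [Function.comp_apply, (chartAt E x).left_inv (hVs hy.1),
    (chartAt E x).left_inv (hVs hz.1)] at h1
  refine h1.trans ?_
  rw [NNReal.coe_mul, Real.coe_toNNReal _ hK, mul_assoc]
  exact mul_le_mul_of_nonneg_left (h y hy.1 z hz.1).2 L.2

/-- A smooth chart is Lipschitz on the compact image of `[a, b]`, so the derivative of the chart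
reading is bounded by a multiple of the speed. -/
lemma MemH1.of_absolutelyContinuous {η : ℝ → M} (hη : AbsolutelyContinuousOnInterval η 0 1)
    (h2 : IntegrableOn (fun t ↦ speed E η t ^ 2) (Icc 0 1)) : MemH1 E η := by
  have hcont := continuousOn_of_absolutelyContinuousOnInterval hη
  rw [uIcc_of_le zero_le_one] at hcont
  refine ⟨hcont, fun φ hφ a b ha hab hb hmaps ↦ ?_⟩
  have hsub : Icc a b ⊆ Icc 0 1 := Icc_subset_Icc ha hb
  have hηab : AbsolutelyContinuousOnInterval η a b := hη.mono (by
    rwa [uIcc_of_le hab.le, uIcc_of_le zero_le_one])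
  obtain ⟨K, hK⟩ := ((locallyLipschitzOn_of_mem_maximalAtlas hφ).mono
    hmaps.image_subset).exists_lipschitzOnWith_of_compact
      (isCompact_Icc.image_of_continuousOn (hcont.mono hsub))
  have hd : ∀ r ∈ Icc a b, ∀ s ∈ Icc a b, dist (φ (η r)) (φ (η s)) ≤ K * dist (η r) (η s) :=
    fun r hr s hs ↦ hK.dist_le_mul _ (mem_image_of_mem _ hr) _ (mem_image_of_mem _ hs)
  have hu : AbsolutelyContinuousOnInterval (fun t ↦ φ (η t)) a b :=
    absolutelyContinuousOnInterval_of_dist_le hηab (C := K) (by rwa [uIcc_of_le hab.le])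
  have hsp := ae_hasSpeedAt_speed (E := E) hab.le hηab
  have hud := ae_differentiableAt_of_absolutelyContinuous hab.le hu
  have hucont := continuousOn_of_absolutelyContinuousOnInterval hu
  rw [uIcc_of_le hab.le] at hucont
  have := FiniteDimensional.complete ℝ E
  rw [← restrict_Ioo_eq_restrict_Icc] at hsp hud
  refine ⟨?_, deriv fun t ↦ φ (η t), ?_, hasWeakDeriv_of_absolutelyContinuous hab.le hu⟩
  · obtain ⟨C, hC⟩ := isCompact_Icc.exists_bound_of_continuousOn hucont
    refine MemLp.of_bound (C := C)
      ((hucont.mono Ioo_subset_Icc_self).aestronglyMeasurable measurableSet_Ioo) ?_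
    filter_upwards [ae_restrict_mem measurableSet_Ioo] with t ht
    exact hC t (Ioo_subset_Icc_self ht)
  · have hmeas := aemeasurable_of_hasSpeedAt (hcont.mono hsub)
      (by rwa [← restrict_Ioo_eq_restrict_Icc])
    rw [← restrict_Ioo_eq_restrict_Icc] at hmeas
    have hL2 : MemLp (speed E η) 2 (volume.restrict (Ioo a b)) :=
      (memLp_two_iff_integrable_sq hmeas.aestronglyMeasurable).2
        (h2.mono_set (Ioo_subset_Icc_self.trans hsub))
    refine hL2.of_le_mul (c := K) (stronglyMeasurable_deriv _).aestronglyMeasurable ?_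
    filter_upwards [hsp, hud, ae_restrict_mem measurableSet_Ioo] with t ht hut hmem
    rw [Real.norm_of_nonneg (speed_nonneg E η t)]
    refine hut.hasDerivAt.hasSpeedAt.le_of_eventually ht ?_
    filter_upwards [Icc_mem_nhds hmem.1 hmem.2] with s hs
    exact hd s hs t (Ioo_subset_Icc_self hmem)

/-- Both properties are additive in the interval, so bi-Lipschitz charts suffice. There the weak
derivative `v` gives `dist (η r) (η s) ≤ ∫ K ‖v‖`, hence absolute continuity and a speed of at most
`K ‖v‖`. -/
lemma MemH1.absolutelyContinuous_and_integrable {η : ℝ → M} (h : MemH1 E η) :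
    AbsolutelyContinuousOnInterval η 0 1 ∧
      IntegrableOn (fun t ↦ speed E η t ^ 2) (Icc 0 1) := by
  obtain ⟨hcont, h⟩ := h
  refine interval_local_to_global (P := fun c d ↦ AbsolutelyContinuousOnInterval η c d ∧
    IntegrableOn (fun t ↦ speed E η t ^ 2) (Icc c d)) zero_lt_one ?_ ?_
  · intro c d e _ hcd hde _ h1 h2
    refine ⟨((distLeIntegral_speed_of_absolutelyContinuous (E := E) hcd.le h1.1).trans hcd.le hde.le
      (distLeIntegral_speed_of_absolutelyContinuous hde.le h2.1)).absolutelyContinuousOnInterval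
        (hcd.le.trans hde.le), ?_⟩
    rw [← Icc_union_Icc_eq_Icc hcd.le hde.le]
    exact h1.2.union h2.2
  · intro t ht
    obtain ⟨K, hK, δ, hδ, hloc⟩ := exists_chartAt_bilipschitz_curve (E := E) hcont ht
    refine ⟨δ, hδ, fun c d hac hcd hdb hsub ↦ ?_⟩
    obtain ⟨hmaps, hbl⟩ := hloc c d hac hcd hdb hsub
    have hcontcd := hcont.mono (Icc_subset_Icc hac hdb)
    obtain ⟨-, v, hv, hweak⟩ := h (chartAt E (η t)) (IsManifold.chart_mem_maximalAtlas _) c d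
      hac hcd hdb hmaps
    have := FiniteDimensional.complete ℝ E
    have hv1 : IntegrableOn v (Icc c d) := by
      rw [IntegrableOn, ← restrict_Ioo_eq_restrict_Icc]
      exact hv.integrable one_le_two
    have hu := hweak.distLeIntegral hcd
      ((chartAt E (η t)).continuousOn.comp hcontcd hmaps) hv1
    have hη : DistLeIntegral η (fun s ↦ K * ‖v s‖) c d := by
      refine ⟨hv1.norm.const_mul K, fun r s hcr hrs hsd ↦ ?_⟩
      rw [intervalIntegral.integral_const_mul]
      exact (hbl r ⟨hcr, hrs.trans hsd⟩ s ⟨hcr.trans hrs, hsd⟩).1.trans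
        (mul_le_mul_of_nonneg_left (hu.2 r s hcr hrs hsd) hK)
    have hac := hη.absolutelyContinuousOnInterval hcd.le
    have hsp := ae_hasSpeedAt_speed (E := E) hcd.le hac
    have hle := hη.ae_speed_le hcd.le hsp
    have hmeas := aemeasurable_of_hasSpeedAt hcontcd hsp
    refine ⟨hac, ?_⟩
    rw [restrict_Ioo_eq_restrict_Icc] at hv
    have hL2 : MemLp (speed E η) 2 (volume.restrict (Icc c d)) := by
      refine hv.of_le_mul (c := K) hmeas.aestronglyMeasurable ?_
      filter_upwards [hle] with s hs
      rw [Real.norm_of_nonneg (speed_nonneg E η s)]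
      rwa [abs_of_nonneg (mul_nonneg hK (norm_nonneg _))] at hs
    exact (memLp_two_iff_integrable_sq hmeas.aestronglyMeasurable).1 hL2

lemma memH1_iff {η : ℝ → M} : MemH1 E η ↔ AbsolutelyContinuousOnInterval η 0 1 ∧
    IntegrableOn (fun t ↦ speed E η t ^ 2) (Icc 0 1) :=
  ⟨MemH1.absolutelyContinuous_and_integrable, fun h ↦ .of_absolutelyContinuous h.1 h.2⟩

end Sobolev

/-! ### Cauchy-Schwarz with its equality case, and locally constant functions. -/

section CauchySchwarz

variable {w : ℝ → ℝ} {a b : ℝ}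

/-- The variance identity: its nonnegative left side yields the inequality, and its vanishing yields
the equality case. -/
lemma integral_sub_mean_sq (hab : a < b) (hw : IntegrableOn w (Icc a b))
    (hw2 : IntegrableOn (fun t ↦ w t ^ 2) (Icc a b)) :
    (b - a) * ∫ t in a..b, (w t - (∫ s in a..b, w s) / (b - a)) ^ 2 =
      (b - a) * (∫ t in a..b, w t ^ 2) - (∫ t in a..b, w t) ^ 2 := by
  have hba : b - a ≠ 0 := (sub_pos.2 hab).ne'
  have hi := (intervalIntegrable_iff_integrableOn_Icc_of_le hab.le).2 hw
  have hi2 := (intervalIntegrable_iff_integrableOn_Icc_of_le hab.le).2 hw2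
  set m := (∫ s in a..b, w s) / (b - a) with hm
  have hm' : ∫ s in a..b, w s = m * (b - a) := by rw [hm, div_mul_cancel₀ _ hba]
  have h1 : ∀ t, (w t - m) ^ 2 = w t ^ 2 - 2 * m * w t + m ^ 2 := fun t ↦ by ring
  simp only [h1]
  rw [intervalIntegral.integral_add (hi2.sub (hi.const_mul _)) (by simp),
    intervalIntegral.integral_sub hi2 (hi.const_mul _), intervalIntegral.integral_const_mul, hm',
    intervalIntegral.integral_const, smul_eq_mul]
  ring

lemma sq_integral_le (hab : a < b) (hw : IntegrableOn w (Icc a b))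
    (hw2 : IntegrableOn (fun t ↦ w t ^ 2) (Icc a b)) :
    (∫ t in a..b, w t) ^ 2 ≤ (b - a) * ∫ t in a..b, w t ^ 2 := by
  have h := integral_sub_mean_sq hab hw hw2
  have : 0 ≤ (b - a) * ∫ t in a..b, (w t - (∫ s in a..b, w s) / (b - a)) ^ 2 :=
    mul_nonneg (sub_pos.2 hab).le (intervalIntegral.integral_nonneg hab.le fun _ _ ↦ sq_nonneg _)
  linarith

/-- The equality case of the Cauchy-Schwarz inequality. -/
lemma ae_eq_const_of_le_sq_integral (hab : a < b) (hw : IntegrableOn w (Icc a b))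
    (hw2 : IntegrableOn (fun t ↦ w t ^ 2) (Icc a b))
    (h : (b - a) * (∫ t in a..b, w t ^ 2) ≤ (∫ t in a..b, w t) ^ 2) :
    ∃ c, ∀ᵐ t ∂volume.restrict (Icc a b), w t = c := by
  have h1 := integral_sub_mean_sq hab hw hw2
  set m := (∫ s in a..b, w s) / (b - a) with hm
  refine ⟨m, ?_⟩
  have hba : 0 < b - a := sub_pos.2 hab
  have hnn : 0 ≤ ∫ t in a..b, (w t - m) ^ 2 :=
    intervalIntegral.integral_nonneg hab.le fun _ _ ↦ sq_nonneg _
  have h0 : ∫ t in a..b, (w t - m) ^ 2 = 0 := by nlinarith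
  rw [intervalIntegral.integral_of_le hab.le, ← integral_Icc_eq_integral_Ioc] at h0
  have hint : IntegrableOn (fun t ↦ (w t - m) ^ 2) (Icc a b) := by
    have h2 : ∀ t, (w t - m) ^ 2 = w t ^ 2 - 2 * m * w t + m ^ 2 := fun t ↦ by ring
    simp only [h2]
    exact (hw2.sub (hw.const_mul _)).add (integrableOn_const (by simp))
  have := (integral_eq_zero_iff_of_nonneg (fun t ↦ sq_nonneg _) hint).1 h0
  filter_upwards [this] with t ht
  simpa [sub_eq_zero] using ht

/-- A function which is almost everywhere constant around every point of `[0, 1]` is almost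
everywhere constant on `[0, 1]`. -/
lemma ae_eq_const_of_locally {w : ℝ → ℝ}
    (h : ∀ t₀ ∈ Icc (0 : ℝ) 1, ∃ δ > 0, ∃ c, ∀ᵐ t ∂volume.restrict
      (Icc 0 1 ∩ Ioo (t₀ - δ) (t₀ + δ)), w t = c) :
    ∃ c, ∀ᵐ t ∂volume.restrict (Icc (0 : ℝ) 1), w t = c := by
  choose! δ hδ k hk using h
  have hconst : ∀ t ∈ Icc (0 : ℝ) 1, ∀ s ∈ Icc (0 : ℝ) 1, s ∈ Metric.ball t (δ t) →
      k s = k t := by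
    intro t ht s hs hst
    have hδt := hδ t ht
    have hδs := hδ s hs
    rw [Metric.mem_ball, Real.dist_eq, abs_lt] at hst
    -- The two windows overlap inside `[0, 1]` in an interval of positive measure, on which `w`
    -- equals both `k s` and `k t` almost everywhere.
    have hlt : max 0 (max (t - δ t) (s - δ s)) < min 1 (min (t + δ t) (s + δ s)) := by
      have := ht.1; have := ht.2; have := hs.1; have := hs.2
      simp only [max_lt_iff, lt_min_iff]
      refine ⟨⟨?_, ?_, ?_⟩, ⟨?_, ?_, ?_⟩, ⟨?_, ?_, ?_⟩⟩ <;> linarith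
    set J := Ioo (max 0 (max (t - δ t) (s - δ s))) (min 1 (min (t + δ t) (s + δ s))) with hJ
    have hJ1 : J ⊆ Icc 0 1 ∩ Ioo (t - δ t) (t + δ t) := fun r hr ↦ by
      simp only [hJ, mem_Ioo, max_lt_iff, lt_min_iff] at hr
      exact ⟨⟨hr.1.1.le, hr.2.1.le⟩, hr.1.2.1, hr.2.2.1⟩
    have hJ2 : J ⊆ Icc 0 1 ∩ Ioo (s - δ s) (s + δ s) := fun r hr ↦ by
      simp only [hJ, mem_Ioo, max_lt_iff, lt_min_iff] at hr
      exact ⟨⟨hr.1.1.le, hr.2.1.le⟩, hr.1.2.2, hr.2.2.2⟩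
    have hne : NeBot (ae (volume.restrict J)) := by
      rw [ae_neBot, Ne, Measure.restrict_eq_zero, hJ, Real.volume_Ioo, ENNReal.ofReal_eq_zero,
        not_le]
      exact sub_pos.2 hlt
    obtain ⟨r, hr1, hr2⟩ := ((ae_restrict_of_ae_restrict_of_subset hJ1 (hk t ht)).and
      (ae_restrict_of_ae_restrict_of_subset hJ2 (hk s hs))).exists
    rw [← hr1, ← hr2]
  -- Carrying the constancy of `k` along with the statement on `w` makes the constants match when
  -- intervals are joined.
  have := interval_local_to_global (P := fun c d ↦ (∀ t ∈ Icc c d, k t = k c) ∧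
    ∀ᵐ t ∂volume.restrict (Icc c d), w t = k c) zero_lt_one ?_ ?_
  · exact ⟨k 0, this.2⟩
  · rintro c d e - hcd hde - ⟨h1, h2⟩ ⟨h3, h4⟩
    have hd := h1 d (right_mem_Icc.2 hcd.le)
    rw [hd] at h3 h4
    rw [← Icc_union_Icc_eq_Icc hcd.le hde.le]
    refine ⟨fun t ht ↦ ht.elim (h1 t) (h3 t), ?_⟩
    exact ae_restrict_union_iff _ _ _ |>.2 ⟨h2, h4⟩
  · intro t ht
    refine ⟨δ t, hδ t ht, fun c d hc hcd hd hsub ↦ ?_⟩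
    have hin : ∀ s ∈ Icc c d, k s = k t := fun s hs ↦
      hconst t ht s ⟨hc.trans hs.1, hs.2.trans hd⟩ (hsub hs)
    rw [hin c (left_mem_Icc.2 hcd.le)]
    refine ⟨hin, ae_restrict_of_ae_restrict_of_subset (fun s hs ↦ ?_) (hk t ht)⟩
    have := hsub hs
    rw [Real.ball_eq_Ioo] at this
    exact ⟨⟨hc.trans hs.1, hs.2.trans hd⟩, this⟩

end CauchySchwarz

/-! ### Splitting integrals and localizing the speed. -/

lemma integral_split {f : ℝ → ℝ} {a b : ℝ} (ha : 0 ≤ a) (hab : a ≤ b) (hb : b ≤ 1)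
    (hf : IntegrableOn f (Icc 0 1)) : ∫ t in (0 : ℝ)..1, f t =
      (∫ t in (0 : ℝ)..a, f t) + (∫ t in a..b, f t) + ∫ t in b..1, f t := by
  have hi : ∀ c ∈ Icc (0 : ℝ) 1, ∀ d ∈ Icc (0 : ℝ) 1, IntervalIntegrable f volume c d :=
    fun c hc d hd ↦ (hf.mono_set (uIcc_subset_Icc hc hd)).intervalIntegrable
  have h0 : (0 : ℝ) ∈ Icc (0 : ℝ) 1 := ⟨le_rfl, zero_le_one⟩
  have h1 : (1 : ℝ) ∈ Icc (0 : ℝ) 1 := ⟨zero_le_one, le_rfl⟩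
  have h2 : a ∈ Icc (0 : ℝ) 1 := ⟨ha, hab.trans hb⟩
  have h3 : b ∈ Icc (0 : ℝ) 1 := ⟨ha.trans hab, hb⟩
  rw [intervalIntegral.integral_add_adjacent_intervals (hi _ h0 _ h2) (hi _ h2 _ h3),
    intervalIntegral.integral_add_adjacent_intervals (hi _ h0 _ h3) (hi _ h3 _ h1)]

lemma eqOn_left_right {M : Type*} {η γ : ℝ → M} {a b : ℝ} (ha : 0 ≤ a) (hab : a ≤ b) (hb : b ≤ 1)
    (heq : EqOn η γ (Icc 0 1 \ Ioo a b)) : EqOn η γ (Icc 0 a) ∧ EqOn η γ (Icc b 1) :=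
  ⟨fun _ ht ↦ heq ⟨⟨ht.1, ht.2.trans (hab.trans hb)⟩, fun h ↦ absurd h.1 (not_lt.2 ht.2)⟩,
    fun _ ht ↦ heq ⟨⟨(ha.trans hab).trans ht.1, ht.2⟩, fun h ↦ absurd h.2 (not_lt.2 ht.1)⟩⟩

section Congr

variable {E : Type*} [NormedAddCommGroup E] [NormedSpace ℝ E]
  {M : Type*} [MetricSpace M] [ChartedSpace E M]
  [RiemannianBundle (fun p : M ↦ TangentSpace 𝓘(ℝ, E) p)]

/-- At `a` and `b` the derivative depends on values outside the interval, but the endpoints form a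
null set. -/
lemma speed_ae_eq_of_eqOn {η ζ : ℝ → M} {a b : ℝ} (h : EqOn η ζ (Icc a b)) :
    speed E η =ᵐ[volume.restrict (Icc a b)] speed E ζ := by
  rw [← restrict_Ioo_eq_restrict_Icc]
  filter_upwards [ae_restrict_mem measurableSet_Ioo] with t ht
  refine speed_congr E ?_
  filter_upwards [Icc_mem_nhds ht.1 ht.2] with s hs using h hs

lemma integral_speed_congr {η ζ : ℝ → M} {a b : ℝ} (hab : a ≤ b) (h : EqOn η ζ (Icc a b))
    (f : ℝ → ℝ) : ∫ t in a..b, f (speed E η t) = ∫ t in a..b, f (speed E ζ t) := by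
  refine intervalIntegral.integral_congr_ae_restrict ?_
  rw [uIoc_of_le hab]
  filter_upwards [ae_restrict_of_ae_restrict_of_subset Ioc_subset_Icc_self
    (speed_ae_eq_of_eqOn (E := E) h)] with t ht
  rw [ht]

lemma hasConstantSpeed_iff {η : ℝ → M} : HasConstantSpeed E η ↔
    ∃ c : ℝ, ∀ᵐ t ∂volume.restrict (Icc (0 : ℝ) 1), speed E η t = c := Iff.rfl

end Congr

/-! ### Length, energy and reparametrized competitors. -/

section Competitors

variable {E : Type*} [NormedAddCommGroup E] [NormedSpace ℝ E] [FiniteDimensional ℝ E]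
  {M : Type*} [MetricSpace M] [ChartedSpace E M] [IsManifold 𝓘(ℝ, E) ∞ M]
  [RiemannianBundle (fun p : M ↦ TangentSpace 𝓘(ℝ, E) p)]
  [IsContinuousRiemannianBundle E (fun p : M ↦ TangentSpace 𝓘(ℝ, E) p)]
  [IsRiemannianManifold 𝓘(ℝ, E) M]

lemma length_eq {η : ℝ → M} (hη : AbsolutelyContinuousOnInterval η 0 1) :
    length E η = ENNReal.ofReal (∫ t in (0 : ℝ)..1, speed E η t) := by
  have hi := (distLeIntegral_speed_of_absolutelyContinuous (E := E) zero_le_one hη).1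
  rw [length, Manifold.pathELength_eq_lintegral_mfderiv_Icc]
  simp only [enorm_mfderiv_eq_ofReal_speed]
  rw [intervalIntegral.integral_of_le zero_le_one, ← integral_Icc_eq_integral_Ioc,
    ofReal_integral_eq_lintegral_ofReal hi (Eventually.of_forall (speed_nonneg E η))]

lemma length_le_length_iff {η ζ : ℝ → M} (hη : AbsolutelyContinuousOnInterval η 0 1)
    (hζ : AbsolutelyContinuousOnInterval ζ 0 1) :
    length E η ≤ length E ζ ↔
      ∫ t in (0 : ℝ)..1, speed E η t ≤ ∫ t in (0 : ℝ)..1, speed E ζ t := by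
  rw [length_eq hη, length_eq hζ, ENNReal.ofReal_le_ofReal_iff]
  exact intervalIntegral.integral_nonneg zero_le_one fun _ _ ↦ speed_nonneg E _ _

variable {S : Set M} {x y : M}

/-- The form in which the Sobolev class is used from here on; charts no longer intervene. -/
lemma mem_admissibleH1_iff {η : ℝ → M} : η ∈ admissibleH1 E S x y ↔ η ∈ admissibleAC S x y ∧
    IntegrableOn (fun t ↦ speed E η t ^ 2) (Icc 0 1) := by
  simp only [admissibleH1, admissibleAC, mem_ofPred_eq, memH1_iff]
  tauto

lemma energy_eq {η : ℝ → M} (hη : η ∈ admissibleH1 E S x y) :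
    energy E S x y η = ENNReal.ofReal (∫ t in (0 : ℝ)..1, speed E η t ^ 2) / 2 := by
  have hi := (mem_admissibleH1_iff.1 hη).2
  rw [energy, if_pos hη]
  simp only [enorm_mfderiv_eq_ofReal_speed]
  rw [intervalIntegral.integral_of_le zero_le_one, ← integral_Icc_eq_integral_Ioc,
    ofReal_integral_eq_lintegral_ofReal hi (Eventually.of_forall fun _ ↦ sq_nonneg _)]
  simp only [ENNReal.ofReal_pow (speed_nonneg E η _)]

lemma energy_le_energy_iff {η ζ : ℝ → M} (hη : η ∈ admissibleH1 E S x y)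
    (hζ : ζ ∈ admissibleH1 E S x y) : energy E S x y η ≤ energy E S x y ζ ↔
      ∫ t in (0 : ℝ)..1, speed E η t ^ 2 ≤ ∫ t in (0 : ℝ)..1, speed E ζ t ^ 2 := by
  rw [energy_eq hη, energy_eq hζ, ENNReal.div_le_iff (by simp) (by simp),
    ENNReal.div_mul_cancel (by simp) (by simp), ENNReal.ofReal_le_ofReal_iff]
  exact intervalIntegral.integral_nonneg zero_le_one fun _ _ ↦ sq_nonneg _

lemma mem_admissibleH1_of_hasConstantSpeed {γ : ℝ → M} (hγ : γ ∈ admissibleAC S x y)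
    (hc : HasConstantSpeed E γ) : γ ∈ admissibleH1 E S x y := by
  obtain ⟨c, hc⟩ := hasConstantSpeed_iff.1 hc
  refine mem_admissibleH1_iff.2 ⟨hγ, ?_⟩
  refine (integrableOn_const (C := c ^ 2) (by simp)).congr ?_
  filter_upwards [hc] with t ht
  rw [ht]

/-- A curve of constant speed has at most the energy of any curve that is not shorter. -/
lemma energy_le_of_length_le {γ η : ℝ → M} (hγ : γ ∈ admissibleAC S x y)
    (hc : HasConstantSpeed E γ) (hη : η ∈ admissibleH1 E S x y)
    (h : length E γ ≤ length E η) : energy E S x y γ ≤ energy E S x y η := by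
  have hγ' := mem_admissibleH1_of_hasConstantSpeed hγ hc
  obtain ⟨hηac, hη2⟩ := mem_admissibleH1_iff.1 hη
  rw [energy_le_energy_iff hγ' hη]
  rw [length_le_length_iff hγ.1 hηac.1] at h
  obtain ⟨c, hc⟩ := hasConstantSpeed_iff.1 hc
  have hc' : ∀ᵐ t ∂volume.restrict (uIoc (0 : ℝ) 1), speed E γ t = c := by
    rw [uIoc_of_le zero_le_one]
    exact ae_restrict_of_ae_restrict_of_subset Ioc_subset_Icc_self hc
  have h1 : ∫ t in (0 : ℝ)..1, speed E γ t = c := by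
    rw [intervalIntegral.integral_congr_ae_restrict (g := fun _ ↦ c) hc']
    simp
  have h2 : ∫ t in (0 : ℝ)..1, speed E γ t ^ 2 = c ^ 2 := by
    rw [intervalIntegral.integral_congr_ae_restrict (g := fun _ ↦ c ^ 2)
      (by filter_upwards [hc'] with t ht; rw [ht])]
    simp
  have h0 : 0 ≤ c := by
    rw [← h1]
    exact intervalIntegral.integral_nonneg zero_le_one fun _ _ ↦ speed_nonneg E _ _
  have hcs := sq_integral_le zero_lt_one
    (distLeIntegral_speed_of_absolutelyContinuous (E := E) zero_le_one hηac.1).1 hη2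
  rw [sub_zero, one_mul] at hcs
  rw [h1] at h
  rw [h2]
  exact (pow_le_pow_left₀ h0 h 2).trans hcs

/-- Replace `η` on `[a, b]` by its reparametrization of (at most) constant speed. -/
lemma exists_admissible_reparam {γ η : ℝ → M} {a b : ℝ} (ha : 0 ≤ a) (hab : a < b) (hb : b ≤ 1)
    (hγ : γ ∈ admissibleAC S x y) (hη : η ∈ admissibleAC S x y)
    (heq : EqOn η γ (Icc 0 1 \ Ioo a b)) :
    ∃ ζ ∈ admissibleAC S x y, EqOn ζ γ (Icc 0 1 \ Ioo a b) ∧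
      ∀ᵐ t ∂volume.restrict (Icc a b),
        speed E ζ t ≤ (∫ s in a..b, speed E η s) / (b - a) := by
  obtain ⟨hγac, hγS, hγ0, hγ1⟩ := hγ
  obtain ⟨hηac, hηS, hη0, hη1⟩ := hη
  have hsub : Icc a b ⊆ Icc 0 1 := Icc_subset_Icc ha hb
  have hamem := left_mem_Icc.2 hab.le
  have hbmem := right_mem_Icc.2 hab.le
  have hD := distLeIntegral_speed_of_absolutelyContinuous (E := E) hab.le (hηac.mono (by
    rwa [uIcc_of_le hab.le, uIcc_of_le zero_le_one]))
  obtain ⟨τ, hτ, hτa, hτb, hτL⟩ := hD.exists_reparam hab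
  set C := (∫ s in a..b, speed E η s) / (b - a) with hC
  classical
  set ζ : ℝ → M := fun t ↦ if t ∈ Ioo a b then η (τ t) else γ t with hζ
  have hζγ : ∀ t, t ∉ Ioo a b → ζ t = γ t := fun t ht ↦ if_neg ht
  -- At the junctions `τ` may move the endpoints, but `η ∘ τ` takes there the values of `η`, which
  -- are those of `γ`.
  have hζη : EqOn ζ (η ∘ τ) (Icc a b) := by
    intro t ht
    by_cases htm : t ∈ Ioo a b
    · exact if_pos htm
    rw [hζγ t htm, ← heq ⟨hsub ht, htm⟩]
    rw [mem_Ioo, not_and_or, not_lt, not_lt] at htm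
    rcases htm with h | h
    · rw [le_antisymm h ht.1]
      exact (dist_eq_zero.1 hτa).symm
    · rw [le_antisymm ht.2 h]
      exact (dist_eq_zero.1 hτb).symm
  have hζL : ∀ s ∈ Icc a b, ∀ t ∈ Icc a b, dist (ζ s) (ζ t) ≤ C * |s - t| := by
    intro s hs t ht
    rw [hζη hs, hζη ht]
    exact hτL s hs t ht
  have hζab : AbsolutelyContinuousOnInterval ζ a b :=
    absolutelyContinuousOnInterval_of_dist_le (g := fun t : ℝ ↦ t) (C := C)
      (LipschitzOnWith.absolutelyContinuousOnInterval LipschitzWith.id.lipschitzOnWith) (by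
        rw [uIcc_of_le hab.le]
        exact hζL)
  have hpiece : ∀ c d, 0 ≤ c → c ≤ d → d ≤ 1 → EqOn ζ γ (Icc c d) →
      AbsolutelyContinuousOnInterval ζ c d := by
    intro c d hc hcd hd h
    refine absolutelyContinuousOnInterval_of_dist_le (g := γ) (C := 1) (hγac.mono ?_) ?_
    · rw [uIcc_of_le hcd, uIcc_of_le zero_le_one]
      exact Icc_subset_Icc hc hd
    · rw [uIcc_of_le hcd]
      intro s hs t ht
      rw [h hs, h ht, one_mul]
  have h0a : EqOn ζ γ (Icc 0 a) := fun t ht ↦ hζγ t fun h ↦ absurd h.1 (not_lt.2 ht.2)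
  have hb1 : EqOn ζ γ (Icc b 1) := fun t ht ↦ hζγ t fun h ↦ absurd h.2 (not_lt.2 ht.1)
  have hζac : AbsolutelyContinuousOnInterval ζ 0 1 := by
    have h1 := distLeIntegral_speed_of_absolutelyContinuous (E := E) ha
      (hpiece 0 a le_rfl ha (hab.le.trans hb) h0a)
    have h2 := distLeIntegral_speed_of_absolutelyContinuous (E := E) hab.le hζab
    have h3 := distLeIntegral_speed_of_absolutelyContinuous (E := E) hb
      (hpiece b 1 (ha.trans hab.le) hb le_rfl hb1)
    exact ((h1.trans ha hab.le h2).trans (ha.trans hab.le) hb h3).absolutelyContinuousOnInterval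
      zero_le_one
  refine ⟨ζ, ⟨hζac, ?_, ?_, ?_⟩, fun t ht ↦ hζγ t ht.2, ?_⟩
  · intro t ht
    by_cases htm : t ∈ Ioo a b
    -- Only points of `η` are visited, so the competitor stays in `S` whatever the set `S` is.
    · rw [hζη (Ioo_subset_Icc_self htm)]
      exact hηS (hsub (hτ (Ioo_subset_Icc_self htm)))
    · rw [hζγ t htm]
      exact hγS ht
  · rw [hζγ 0 fun h ↦ absurd h.1 (not_lt.2 ha), hγ0]
  · rw [hζγ 1 fun h ↦ absurd h.2 (not_lt.2 hb), hγ1]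
  · have hsp := ae_hasSpeedAt_speed (E := E) hab.le hζab
    rw [← restrict_Ioo_eq_restrict_Icc] at hsp ⊢
    filter_upwards [hsp, ae_restrict_mem measurableSet_Ioo] with t ht hmem
    exact ht.le_of_lipschitzOnWith (Icc_mem_nhds hmem.1 hmem.2) hζL

/-- If the speed of `ζ` is bounded on `[a, b]` and square integrable on the complement, then `ζ` is
of class `H¹`. -/
lemma mem_admissibleH1_of_speed_le {ζ : ℝ → M} {a b C : ℝ} (hab : a ≤ b)
    (hζ : ζ ∈ admissibleAC S x y) (hC : ∀ᵐ t ∂volume.restrict (Icc a b), speed E ζ t ≤ C)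
    (h0a : IntegrableOn (fun t ↦ speed E ζ t ^ 2) (Icc 0 a))
    (hb1 : IntegrableOn (fun t ↦ speed E ζ t ^ 2) (Icc b 1)) (ha : 0 ≤ a) (hb : b ≤ 1) :
    ζ ∈ admissibleH1 E S x y := by
  refine mem_admissibleH1_iff.2 ⟨hζ, ?_⟩
  rw [← Icc_union_Icc_eq_Icc (ha.trans hab) hb, ← Icc_union_Icc_eq_Icc ha hab]
  refine (h0a.union ?_).union hb1
  have hmeas := ((distLeIntegral_speed_of_absolutelyContinuous (E := E) zero_le_one hζ.1).1.mono_set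
    (Icc_subset_Icc ha hb)).aestronglyMeasurable
  refine Integrable.mono' (g := fun _ ↦ C ^ 2) (integrableOn_const (by simp)) (hmeas.pow 2) ?_
  filter_upwards [hC] with t ht
  rw [Real.norm_of_nonneg (sq_nonneg _)]
  exact pow_le_pow_left₀ (speed_nonneg E ζ t) ht 2

/-- The energy on `[a, b]` of a curve whose energy is minimal among the curves that differ from it
only in `(a, b)` is controlled by the length of these curves. -/
lemma energy_le_sq_length_of_minimal {γ η : ℝ → M} {a b : ℝ} (ha : 0 ≤ a) (hab : a < b)
    (hb : b ≤ 1) (hγ : γ ∈ admissibleH1 E S x y)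
    (hmin : ∀ η ∈ admissibleH1 E S x y, EqOn η γ (Icc 0 1 \ Ioo a b) →
      energy E S x y γ ≤ energy E S x y η)
    (hη : η ∈ admissibleAC S x y) (heq : EqOn η γ (Icc 0 1 \ Ioo a b)) :
    (b - a) * ∫ t in a..b, speed E γ t ^ 2 ≤ (∫ t in a..b, speed E η t) ^ 2 := by
  obtain ⟨hγac, hγ2⟩ := mem_admissibleH1_iff.1 hγ
  obtain ⟨ζ, hζ, hζγ, hζC⟩ := exists_admissible_reparam (E := E) ha hab hb hγac hη heq
  set C := (∫ s in a..b, speed E η s) / (b - a) with hC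
  obtain ⟨h0a, hb1⟩ := eqOn_left_right ha hab.le hb hζγ
  have hcongr : ∀ {c d}, Icc c d ⊆ Icc 0 1 → EqOn ζ γ (Icc c d) →
      IntegrableOn (fun t ↦ speed E ζ t ^ 2) (Icc c d) := fun hcd h ↦ by
    refine (hγ2.mono_set hcd).congr ?_
    filter_upwards [speed_ae_eq_of_eqOn (E := E) h] with t ht
    rw [ht]
  have hζH := mem_admissibleH1_of_speed_le hab.le hζ hζC
    (hcongr (Icc_subset_Icc_right (hab.le.trans hb)) h0a)
    (hcongr (Icc_subset_Icc_left (ha.trans hab.le)) hb1) ha hb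
  have hζ2 := (mem_admissibleH1_iff.1 hζH).2
  -- The energies of `γ` and `ζ` outside `[a, b]` coincide and cancel, leaving the comparison on
  -- `[a, b]`.
  have hle := (energy_le_energy_iff hγ hζH).1 (hmin ζ hζH hζγ)
  rw [integral_split ha hab.le hb hγ2, integral_split ha hab.le hb hζ2,
    integral_speed_congr ha h0a (· ^ 2), integral_speed_congr hb hb1 (· ^ 2)] at hle
  have hζint : ∫ t in a..b, speed E ζ t ^ 2 ≤ (b - a) * C ^ 2 := by
    have hi := hζ2.mono_set (Icc_subset_Icc ha hb)
    have := intervalIntegral.integral_mono_ae_restrict (g := fun _ ↦ C ^ 2) hab.le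
      ((intervalIntegrable_iff_integrableOn_Icc_of_le hab.le).2 hi) (by simp)
      (by filter_upwards [hζC] with t ht using pow_le_pow_left₀ (speed_nonneg E ζ t) ht 2)
    simpa using this
  have hba : 0 < b - a := sub_pos.2 hab
  calc (b - a) * ∫ t in a..b, speed E γ t ^ 2 ≤ (b - a) * ((b - a) * C ^ 2) :=
        mul_le_mul_of_nonneg_left (by linarith) hba.le
    _ = (C * (b - a)) ^ 2 := by ring
    _ = _ := by rw [hC, div_mul_cancel₀ _ hba.ne']

/-- With `γ` as its own competitor, the previous bound is the reverse Cauchy-Schwarz inequality. -/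
lemma ae_speed_eq_const_of_minimal {γ : ℝ → M} {a b : ℝ} (ha : 0 ≤ a) (hab : a < b)
    (hb : b ≤ 1) (hγ : γ ∈ admissibleH1 E S x y)
    (hmin : ∀ η ∈ admissibleH1 E S x y, EqOn η γ (Icc 0 1 \ Ioo a b) →
      energy E S x y γ ≤ energy E S x y η) :
    ∃ c, ∀ᵐ t ∂volume.restrict (Icc a b), speed E γ t = c := by
  obtain ⟨hγac, hγ2⟩ := mem_admissibleH1_iff.1 hγ
  have hsub : Icc a b ⊆ Icc 0 1 := Icc_subset_Icc ha hb
  exact ae_eq_const_of_le_sq_integral hab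
    ((distLeIntegral_speed_of_absolutelyContinuous (E := E) zero_le_one hγac.1).1.mono_set hsub)
    (hγ2.mono_set hsub)
    (energy_le_sq_length_of_minimal ha hab hb hγ hmin hγac fun _ _ ↦ rfl)

/-- On `[a, b]`, `L(γ)² ≤ (b - a) ∫ ‖γ'‖² ≤ L(η)²`; outside, the two curves agree. -/
lemma length_le_of_minimal {γ η : ℝ → M} {a b : ℝ} (ha : 0 ≤ a) (hab : a < b)
    (hb : b ≤ 1) (hγ : γ ∈ admissibleH1 E S x y)
    (hmin : ∀ η ∈ admissibleH1 E S x y, EqOn η γ (Icc 0 1 \ Ioo a b) →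
      energy E S x y γ ≤ energy E S x y η)
    (hη : η ∈ admissibleAC S x y) (heq : EqOn η γ (Icc 0 1 \ Ioo a b)) :
    length E γ ≤ length E η := by
  obtain ⟨hγac, hγ2⟩ := mem_admissibleH1_iff.1 hγ
  have hsub : Icc a b ⊆ Icc 0 1 := Icc_subset_Icc ha hb
  have hγi := (distLeIntegral_speed_of_absolutelyContinuous (E := E) zero_le_one hγac.1).1
  have hηi := (distLeIntegral_speed_of_absolutelyContinuous (E := E) zero_le_one hη.1).1
  have h1 := energy_le_sq_length_of_minimal ha hab hb hγ hmin hη heq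
  have h2 := sq_integral_le hab (hγi.mono_set hsub) (hγ2.mono_set hsub)
  have h3 := abs_le_of_sq_le_sq (h2.trans h1)
    (intervalIntegral.integral_nonneg hab.le fun _ _ ↦ speed_nonneg E _ _)
  obtain ⟨h0a, hb1⟩ := eqOn_left_right ha hab.le hb heq
  rw [length_le_length_iff hγac.1 hη.1, integral_split ha hab.le hb hγi,
    integral_split ha hab.le hb hηi, integral_speed_congr ha h0a fun r ↦ r,
    integral_speed_congr hb hb1 fun r ↦ r]
  linarith [le_abs_self (∫ t in a..b, speed E γ t)]

lemma eqOn_endpoints {M : Type*} [MetricSpace M] {S : Set M} {x y : M} {η γ : ℝ → M}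
    (hη : η ∈ admissibleAC S x y) (hγ : γ ∈ admissibleAC S x y) :
    EqOn η γ (Icc 0 1 \ Ioo 0 1) := by
  rw [Icc_sdiff_Ioo_same zero_le_one]
  rintro t (rfl | rfl)
  · rw [hη.2.2.1, hγ.2.2.1]
  · rw [hη.2.2.2, hγ.2.2.2]

/-- An absolutely continuous curve that minimizes the energy is of class `H¹`, as it has a
competitor of finite energy. -/
lemma mem_admissibleH1_of_energy_minimal {γ : ℝ → M} (hγ : γ ∈ admissibleAC S x y)
    (hmin : ∀ η ∈ admissibleH1 E S x y, energy E S x y γ ≤ energy E S x y η) :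
    γ ∈ admissibleH1 E S x y := by
  obtain ⟨ζ, hζ, -, hζC⟩ := exists_admissible_reparam (E := E) le_rfl zero_lt_one le_rfl hγ hγ
    fun _ _ ↦ rfl
  have hζH := mem_admissibleH1_of_speed_le zero_le_one hζ hζC (by simp) (by simp) le_rfl le_rfl
  by_contra hγH
  have h := hmin ζ hζH
  rw [energy_eq hζH, energy, if_neg hγH, top_le_iff] at h
  exact ENNReal.div_ne_top ENNReal.ofReal_ne_top two_ne_zero h

end Competitors

/-! ### The two equivalences. -/

section Main

variable {E : Type*} [NormedAddCommGroup E] [NormedSpace ℝ E]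
  {M : Type*} [MetricSpace M] [ChartedSpace E M] [IsManifold 𝓘(ℝ, E) ∞ M]
  [RiemannianBundle (fun p : M ↦ TangentSpace 𝓘(ℝ, E) p)]

lemma isContinuousRiemannianBundle_of_isContMDiffRiemannianBundle
    [h : IsContMDiffRiemannianBundle 𝓘(ℝ, E) ∞ E (fun p : M ↦ TangentSpace 𝓘(ℝ, E) p)] :
    IsContinuousRiemannianBundle E (fun p : M ↦ TangentSpace 𝓘(ℝ, E) p) := by
  obtain ⟨g, hg, hg'⟩ := h.exists_contMDiff
  exact ⟨g, hg.continuous, hg'⟩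

end Main

end CurveSpace

theorem theorem3p3 {E : Type*} [NormedAddCommGroup E] [NormedSpace ℝ E] [FiniteDimensional ℝ E]
    {M : Type*} [MetricSpace M] [ChartedSpace E M] [IsManifold 𝓘(ℝ, E) ∞ M]
    [RiemannianBundle (fun p : M ↦ TangentSpace 𝓘(ℝ, E) p)]
    [IsContMDiffRiemannianBundle 𝓘(ℝ, E) ∞ E (fun p : M ↦ TangentSpace 𝓘(ℝ, E) p)]
    [IsRiemannianManifold 𝓘(ℝ, E) M]
    (S : Set M) (x y : M) (γ : ℝ → M) (hγ : γ ∈ CurveSpace.admissibleAC S x y) :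
    (((∀ η ∈ CurveSpace.admissibleAC S x y, CurveSpace.length E γ ≤ CurveSpace.length E η) ∧
        CurveSpace.HasConstantSpeed E γ) ↔
      ∀ η ∈ CurveSpace.admissibleH1 E S x y,
        CurveSpace.energy E S x y γ ≤ CurveSpace.energy E S x y η) ∧
    ((CurveSpace.IsLocallyMinimizing E S γ ∧ CurveSpace.HasConstantSpeed E γ) ↔
      γ ∈ CurveSpace.admissibleH1 E S x y ∧
        ∀ t₀ ∈ Icc (0 : ℝ) 1, ∃ h : ℝ, 0 < h ∧ ∀ η ∈ CurveSpace.admissibleH1 E S x y,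
          EqOn η γ (Icc 0 1 \ Ioo (t₀ - h) (t₀ + h)) →
            CurveSpace.energy E S x y γ ≤ CurveSpace.energy E S x y η) := by
  have := CurveSpace.isContinuousRiemannianBundle_of_isContMDiffRiemannianBundle (E := E) (M := M)
  refine ⟨⟨fun ⟨hmin, hc⟩ η hη ↦ CurveSpace.energy_le_of_length_le hγ hc hη
      (hmin η (CurveSpace.mem_admissibleH1_iff.1 hη).1), fun hmin ↦ ?_⟩,
    ⟨fun ⟨hloc, hc⟩ ↦ ⟨CurveSpace.mem_admissibleH1_of_hasConstantSpeed hγ hc, fun t₀ ht₀ ↦ ?_⟩,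
      fun ⟨hγH, hloc⟩ ↦ ?_⟩⟩
  · have hγH := CurveSpace.mem_admissibleH1_of_energy_minimal hγ hmin
    -- Global minimality is the window `(0, 1)`, since only agreement at the two endpoints is then
    -- required.
    have hmin' : ∀ η ∈ CurveSpace.admissibleH1 E S x y, EqOn η γ (Icc 0 1 \ Ioo 0 1) →
        CurveSpace.energy E S x y γ ≤ CurveSpace.energy E S x y η := fun η hη _ ↦ hmin η hη
    exact ⟨fun η hη ↦ CurveSpace.length_le_of_minimal le_rfl zero_lt_one le_rfl hγH hmin' hη
        (CurveSpace.eqOn_endpoints hη hγ), CurveSpace.hasConstantSpeed_iff.2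
      (CurveSpace.ae_speed_eq_const_of_minimal le_rfl zero_lt_one le_rfl hγH hmin')⟩
  · obtain ⟨h, hh, hle⟩ := hloc.2.2 t₀ ht₀
    rw [hγ.2.2.1, hγ.2.2.2] at hle
    exact ⟨h, hh, fun η hη heq ↦ CurveSpace.energy_le_of_length_le hγ hc hη
      (hle η (CurveSpace.mem_admissibleH1_iff.1 hη).1 heq)⟩
  -- The windows are clipped to `[0, 1]`, as the interval lemmas require. Shrinking a window only
  -- removes competitors, so minimality persists.
  · have hloc' : ∀ t₀ ∈ Icc (0 : ℝ) 1, ∃ h : ℝ, 0 < h ∧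
        max 0 (t₀ - h) < min 1 (t₀ + h) ∧
        ∀ η ∈ CurveSpace.admissibleH1 E S x y,
          EqOn η γ (Icc 0 1 \ Ioo (max 0 (t₀ - h)) (min 1 (t₀ + h))) →
            CurveSpace.energy E S x y γ ≤ CurveSpace.energy E S x y η := by
      intro t₀ ht₀
      obtain ⟨h, hh, hle⟩ := hloc t₀ ht₀
      refine ⟨h, hh, ?_, fun η hη heq ↦ hle η hη (heq.mono (sdiff_subset_sdiff_right
        (Ioo_subset_Ioo (le_max_right _ _) (min_le_right _ _))))⟩
      simp only [max_lt_iff, lt_min_iff]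
      refine ⟨⟨?_, ?_⟩, ?_, ?_⟩ <;> linarith [ht₀.1, ht₀.2]
    refine ⟨⟨hγ.1, hγ.2.1, fun t₀ ht₀ ↦ ?_⟩, CurveSpace.hasConstantSpeed_iff.2
      (CurveSpace.ae_eq_const_of_locally fun t₀ ht₀ ↦ ?_)⟩
    · obtain ⟨h, hh, hlt, hle⟩ := hloc' t₀ ht₀
      rw [hγ.2.2.1, hγ.2.2.2]
      refine ⟨h, hh, fun η hη heq ↦ CurveSpace.length_le_of_minimal (le_max_left _ _) hlt
        (min_le_left _ _) hγH hle hη fun t ht ↦ ?_⟩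
      -- Clipping adds at most the points `0` and `1` to the set of required agreement, and there
      -- all curves of the class agree.
      by_cases ht' : t ∈ Ioo (0 : ℝ) 1
      · refine heq ⟨ht.1, fun htm ↦ ht.2 ?_⟩
        exact ⟨max_lt ht'.1 htm.1, lt_min ht'.2 htm.2⟩
      · exact CurveSpace.eqOn_endpoints hη hγ ⟨ht.1, ht'⟩
    · obtain ⟨h, hh, hlt, hle⟩ := hloc' t₀ ht₀
      obtain ⟨c, hc⟩ := CurveSpace.ae_speed_eq_const_of_minimal (le_max_left _ _) hlt
        (min_le_left _ _) hγH hle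
      refine ⟨h, hh, c, ae_restrict_of_ae_restrict_of_subset (fun t ht ↦ ?_) hc⟩
      exact ⟨max_le ht.1.1 ht.2.1.le, le_min ht.1.2 ht.2.2.le⟩
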